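/- Let $\{\xi_i\}_{i\ge 0}$ be a centered stationary Gaussian sequence with $\mathbb{E}\,\xi_i^2=1$ whose correlation function $\rho(i):=\mathbb{E}[\xi_0\xi_i]$ is non-negative and summable, i.e. $\rho(i)\ge 0$ for all $i\ge 0$ and $\sum_{i=0}^\infty\rho(i)<\infty$. Let $\{\sigma(i)\}_{i\ge 1}$ be a sequence of positive real numbers, and put $s(n):=\big(\sum_{i=1}^n\sigma(i)^2\big)^{1/2}$. Assume that 1. $\lim_{n\to\infty}s(n)=\infty$; 2. $\lim_{n\to\infty}\sigma(n+\ell)/\sigma(n)=1$ for every integer $\ell\ge 1$; 3. there is a constant $C<\infty$ such that $\frac{\sigma(m)}{s(m)}\le C\,\frac{\sigma(n)}{s(n)}$ for all integers $m\ge n\ge 1$. Let $S_\ell:=\sum_{i=1}^\ell\sigma(i)\xi_i$ and $q_n:=\mathbb{P}\big(\max_{1\le\ell\le n}S_\ell<0\big)$. Then $$\lim_{n\to\infty}\frac{\log q_n}{\log s(n)}=-1.$$ -/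

import Mathlib

open MeasureTheory ProbabilityTheory Filter Topology

namespace WeightedPersistence

/-- A real sequence of random variables is stationary if the law of the whole sequence is
invariant under every time shift. -/
def IsStationary {Ω : Type*} [MeasurableSpace Ω] (ξ : ℕ → Ω → ℝ) (P : Measure Ω) : Prop :=
  ∀ k : ℕ, IdentDistrib (fun ω (i : ℕ) => ξ (i + k) ω) (fun ω (i : ℕ) => ξ i ω) P P

/-- The correlation function `ρ(i) = E[ξ₀ ξᵢ]`. -/
noncomputable def corr {Ω : Type*} [MeasurableSpace Ω] (ξ : ℕ → Ω → ℝ) (P : Measure Ω)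
    (i : ℕ) : ℝ :=
  ∫ ω, ξ 0 ω * ξ i ω ∂P

/-- The weighted partial sum `S_ℓ = ∑_{i=1}^ℓ σ(i) ξᵢ`. -/
noncomputable def partialSum {Ω : Type*} (σ : ℕ → ℝ) (ξ : ℕ → Ω → ℝ) (l : ℕ) (ω : Ω) : ℝ :=
  ∑ i ∈ Finset.Icc 1 l, σ i * ξ i ω

/-- `s(n)`, with `s(n)² = ∑_{i=1}^n σ(i)²` and `s(n) ≥ 0`. -/
noncomputable def scale (σ : ℕ → ℝ) (n : ℕ) : ℝ :=
  Real.sqrt (∑ i ∈ Finset.Icc 1 n, σ i ^ 2)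

/-- The persistence probability `q_n = P(max_{1 ≤ ℓ ≤ n} S_ℓ < 0)`. -/
noncomputable def persistenceProb {Ω : Type*} [MeasurableSpace Ω] (σ : ℕ → ℝ) (ξ : ℕ → Ω → ℝ)
    (P : Measure Ω) (n : ℕ) : ℝ :=
  P.real {ω | ∀ l ∈ Finset.Icc 1 n, partialSum σ ξ l ω < 0}

end WeightedPersistence

/-!
For the lower bound, Slepian's inequality compares `S` with the Gaussian walk whose independent
increments have variances `Var S (k + 1) - Var S k`: since the correlations are non-negative, the
covariances of `S` dominate those of the walk. A discrete form of the survival probability of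
Brownian motion then bounds the persistence probability below by a multiple of `1 / s n`.

For the upper bound, `S` is observed only at times along which `s ^ 2` grows by a factor close
to `1 + η`. The normalized block sums have a covariance matrix `R` with non-negative entries,
`R ≤ 1` by the Schur test, and diagonal entries at least `1 - e`; together these force
`R ≥ 1 - 2 e`. Hence the density of `N` block sums is at most `(1 - 2 e) ^ (-N / 2)` times the
standard Gaussian one, and only the persistence of a walk with independent increments is left.
Let `τ k` be the standard deviation of that walk at its `k`-th step. The mean of
`2 * √η * τ k - w` over the surviving positions `w < 0` grows by a factor of at most `1 + δ * η`
per step and is at least `2 * √η * τ k` times the survival probability. Since `N` is at most of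
order `log (s n) / η`, the persistence probability is at most a multiple of `s n ^ (δ - 1)`, after
`δ` has been rescaled.
-/

namespace WeightedPersistence

open scoped Matrix RealInnerProductSpace ENNReal NNReal

/-! ### Gaussian vectors and their orthant probabilities -/

section GaussianVector

variable {ι Ω : Type*} [Fintype ι] [MeasurableSpace Ω] {P : Measure Ω} {X : ι → Ω → ℝ}

/-- The matrix of covariances of a finite family of real random variables. -/
noncomputable def covarianceMatrix (X : ι → Ω → ℝ) (P : Measure Ω) : Matrix ι ι ℝ :=
  .of fun i j => cov[X i, X j; P]

lemma dotProduct_covarianceMatrix_mulVec [IsFiniteMeasure P] (hX : ∀ i, MemLp (X i) 2 P)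
    (x : ι → ℝ) :
    x ⬝ᵥ covarianceMatrix X P *ᵥ x = Var[fun ω => ∑ i, x i * X i ω; P] := by
  rw [variance_fun_sum fun i => (hX i).const_mul (x i)]
  simp only [covarianceMatrix, dotProduct, Matrix.mulVec, Matrix.of_apply, Finset.mul_sum,
    covariance_const_mul_left, covariance_const_mul_right]
  exact Finset.sum_congr rfl fun i _ => Finset.sum_congr rfl fun j _ => by ring

omit [Fintype ι] in
lemma posSemidef_covarianceMatrix [Finite ι] [IsFiniteMeasure P] (hX : ∀ i, MemLp (X i) 2 P) :
    (covarianceMatrix X P).PosSemidef := by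
  have := Fintype.ofFinite ι
  refine Matrix.PosSemidef.of_dotProduct_mulVec_nonneg ?_ fun x => ?_
  · ext i j
    exact covariance_comm _ _
  · rw [star_trivial, dotProduct_covarianceMatrix_mulVec hX]
    exact variance_nonneg _ _

variable [DecidableEq ι]

lemma map_toLp_eq_multivariateGaussian (hX : HasGaussianLaw (fun ω i => X i ω) P) :
    P.map (fun ω => WithLp.toLp 2 fun i => X i ω) =
      multivariateGaussian (WithLp.toLp 2 fun i => P[X i]) (covarianceMatrix X P) := by
  have := hX.isProbabilityMeasure
  have hXL : ∀ i, MemLp (X i) 2 P := fun i => (hX.eval i).memLp_two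
  have hG : HasGaussianLaw (fun ω => WithLp.toLp 2 fun i => X i ω) P := hX.toLp_pi 2
  have := hG.isGaussian_map
  apply IsGaussian.ext
  · simp only [id_eq, integral_id_multivariateGaussian]
    rw [integral_map hG.aemeasurable (by fun_prop)]
    ext i
    exact ((EuclideanSpace.proj (𝕜 := ℝ) i).integral_comp_comm hG.integrable).symm
  · rw [← ContinuousLinearMap.toBilinForm_inj]
    refine LinearMap.BilinForm.ext_basis (EuclideanSpace.basisFun ι ℝ).toBasis fun i j => ?_
    have hcoord : ∀ i : ι, (fun u => ⟪(EuclideanSpace.basisFun ι ℝ).toBasis i, u⟫) ∘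
        (fun ω => WithLp.toLp 2 fun i => X i ω) = X i := fun i => by
      ext
      simp [PiLp.inner_apply]
    rw [ContinuousLinearMap.toBilinForm_apply, ContinuousLinearMap.toBilinForm_apply,
      covarianceBilin_apply_eq_cov IsGaussian.memLp_two_id,
      covarianceBilin_multivariateGaussian (posSemidef_covarianceMatrix hXL),
      covariance_map (by fun_prop) (by fun_prop) hG.aemeasurable, hcoord, hcoord]
    simp [covarianceMatrix]

lemma multivariateGaussian_conv_multivariateGaussian (μ ν : EuclideanSpace ℝ ι)
    {S T : Matrix ι ι ℝ} (hS : S.PosSemidef) (hT : T.PosSemidef) :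
    multivariateGaussian μ S ∗ multivariateGaussian ν T = multivariateGaussian (μ + ν) (S + T) := by
  apply Measure.ext_of_charFun
  ext t
  rw [charFun_conv, charFun_multivariateGaussian hS, charFun_multivariateGaussian hT,
    charFun_multivariateGaussian (hS.add hT), ← Complex.exp_add, Matrix.add_mulVec,
    dotProduct_add, inner_add_right]
  congr 1
  push_cast
  ring

omit [Fintype ι] [DecidableEq ι] in
lemma posSemidef_vecMulVec_self [Finite ι] (v : ι → ℝ) : (Matrix.vecMulVec v v).PosSemidef := by
  simpa only [star_trivial] using Matrix.posSemidef_vecMulVec_self_star v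

lemma map_smul_gaussianReal (v : ι → ℝ) :
    (gaussianReal 0 1).map (fun g => g • WithLp.toLp 2 v) =
      multivariateGaussian 0 (Matrix.vecMulVec v v) := by
  have := Measure.isProbabilityMeasure_map (μ := gaussianReal 0 1)
    (f := fun g : ℝ => g • WithLp.toLp 2 v) (by fun_prop)
  apply Measure.ext_of_charFun
  ext t
  have hquad : t.ofLp ⬝ᵥ Matrix.vecMulVec v v *ᵥ t.ofLp = ⟪WithLp.toLp 2 v, t⟫ ^ 2 := by
    rw [Matrix.vecMulVec_mulVec]
    simp [EuclideanSpace.inner_eq_star_dotProduct, dotProduct_comm, sq]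
  have hinner : ∀ g : ℝ, ⟪g • WithLp.toLp 2 v, t⟫ = ⟪g, ⟪WithLp.toLp 2 v, t⟫⟫ := fun g => by
    simp [real_inner_smul_left, mul_comm]
  rw [charFun_apply, integral_map (by fun_prop) (by fun_prop)]
  simp_rw [hinner]
  rw [← charFun_apply, charFun_gaussianReal,
    charFun_multivariateGaussian (posSemidef_vecMulVec_self v), hquad]
  simp

lemma map_smul_stdGaussian (c : ℝ) :
    (stdGaussian (EuclideanSpace ℝ ι)).map (c • ·) =
      multivariateGaussian 0 (c ^ 2 • (1 : Matrix ι ι ℝ)) := by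
  have := Measure.isProbabilityMeasure_map (μ := stdGaussian (EuclideanSpace ℝ ι))
    (f := (c • ·)) (by fun_prop)
  apply Measure.ext_of_charFun
  ext t
  have hquad : t.ofLp ⬝ᵥ (c ^ 2 • (1 : Matrix ι ι ℝ)) *ᵥ t.ofLp = ‖c • t‖ ^ 2 := by
    rw [norm_smul, mul_pow, Real.norm_eq_abs, sq_abs, EuclideanSpace.real_norm_sq_eq,
      Matrix.smul_mulVec, Matrix.one_mulVec, dotProduct_smul]
    simp [dotProduct, sq]
  rw [charFun_map_smul, charFun_stdGaussian,
    charFun_multivariateGaussian (Matrix.PosSemidef.one.smul (sq_nonneg c)), hquad]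
  simp [neg_div]

end GaussianVector

section Orthant

variable {ι : Type*} [Fintype ι] [DecidableEq ι]

/-- The probability that a centred Gaussian vector with covariance matrix `S` lies strictly
below `b` in every coordinate. -/
noncomputable def orthantProb (b : ι → ℝ) (S : Matrix ι ι ℝ) : ℝ≥0∞ :=
  multivariateGaussian 0 S {x | ∀ i, x i < b i}

omit [Fintype ι] [DecidableEq ι] in
lemma measurableSet_orthant [Countable ι] (b : ι → ℝ) :
    MeasurableSet {x : EuclideanSpace ℝ ι | ∀ i, x i < b i} := by
  rw [Set.ofPred_forall]
  exact MeasurableSet.iInter fun i => measurableSet_lt (by fun_prop) measurable_const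

lemma measure_lt_eq_orthantProb {Ω : Type*} [MeasurableSpace Ω] {P : Measure Ω} {X : ι → Ω → ℝ}
    (hX : HasGaussianLaw (fun ω i => X i ω) P) (hmean : ∀ i, P[X i] = 0) (b : ι → ℝ) :
    P {ω | ∀ i, X i ω < b i} = orthantProb b (covarianceMatrix X P) := by
  have hmap := map_toLp_eq_multivariateGaussian hX
  simp only [hmean] at hmap
  rw [orthantProb, ← WithLp.toLp_zero (2 : ℝ≥0∞), show (0 : ι → ℝ) = fun _ => 0 from rfl, ← hmap,
    Measure.map_apply_of_aemeasurable (hX.toLp_pi 2).aemeasurable (measurableSet_orthant b)]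
  rfl

lemma orthantProb_add (b : ι → ℝ) {S T : Matrix ι ι ℝ} (hS : S.PosSemidef) (hT : T.PosSemidef) :
    orthantProb b (S + T) =
      ∫⁻ u, orthantProb (fun i => b i - u i) T ∂multivariateGaussian 0 S := by
  have hconv := multivariateGaussian_conv_multivariateGaussian 0 0 hS hT
  rw [zero_add] at hconv
  simp only [orthantProb, lt_sub_iff_add_lt']
  rw [← hconv, Measure.conv, Measure.map_apply (by fun_prop) (measurableSet_orthant b),
    Measure.prod_apply ((measurableSet_orthant b).preimage (by fun_prop))]
  rfl

lemma orthantProb_add_le_orthantProb_add (b : ι → ℝ) {S T T' : Matrix ι ι ℝ} (hS : S.PosSemidef)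
    (hT : T.PosSemidef) (hT' : T'.PosSemidef) (h : ∀ b, orthantProb b T ≤ orthantProb b T') :
    orthantProb b (S + T) ≤ orthantProb b (S + T') := by
  rw [orthantProb_add b hS hT, orthantProb_add b hS hT']
  exact lintegral_mono fun u => h _

lemma orthantProb_vecMulVec (b v : ι → ℝ) :
    orthantProb b (Matrix.vecMulVec v v) = gaussianReal 0 1 {g | ∀ i, g * v i < b i} := by
  rw [orthantProb, ← map_smul_gaussianReal, Measure.map_apply (by fun_prop)
    (measurableSet_orthant b)]
  rfl

lemma orthantProb_vecMulVec_add_vecMulVec (b v w : ι → ℝ) :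
    orthantProb b (Matrix.vecMulVec v v + Matrix.vecMulVec w w) =
      ((gaussianReal 0 1).prod (gaussianReal 0 1)) {p | ∀ i, p.1 * v i + p.2 * w i < b i} := by
  have hconv := multivariateGaussian_conv_multivariateGaussian 0 0
    (posSemidef_vecMulVec_self v) (posSemidef_vecMulVec_self w)
  rw [zero_add] at hconv
  rw [orthantProb, ← hconv, Measure.conv, ← map_smul_gaussianReal, ← map_smul_gaussianReal,
    Measure.map_prod_map _ _ (by fun_prop) (by fun_prop), Measure.map_map (by fun_prop)
    (by fun_prop), Measure.map_apply (by fun_prop) (measurableSet_orthant b)]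
  rfl

end Orthant

/-! ### Slepian's inequality -/

section Slepian

lemma measure_mul_measure_le_measure_inter {α : Type*} [MeasurableSpace α] {μ : Measure α}
    [IsProbabilityMeasure μ] {A B : Set α} (h : A ⊆ B ∨ B ⊆ A) : μ A * μ B ≤ μ (A ∩ B) := by
  rcases h with h | h
  · rw [Set.inter_eq_left.2 h]
    exact mul_le_of_le_one_right' prob_le_one
  · rw [Set.inter_eq_right.2 h]
    exact mul_le_of_le_one_left' prob_le_one

variable {ι : Type*} [Fintype ι] [DecidableEq ι]

-- Two coordinates perturbed by the same noise stay below their barriers on an intersection of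
-- two nested half-lines, and nested events are positively correlated.
lemma orthantProb_independent_noise_le_shared_noise (b : ι → ℝ) {i j : ι} (hij : i ≠ j) (r : ℝ) :
    orthantProb b (Matrix.vecMulVec (Pi.single i r) (Pi.single i r) +
        Matrix.vecMulVec (Pi.single j r) (Pi.single j r)) ≤
      orthantProb b (Matrix.vecMulVec (Pi.single i r + Pi.single j r)
        (Pi.single i r + Pi.single j r)) := by
  rw [orthantProb_vecMulVec_add_vecMulVec, orthantProb_vecMulVec]
  set A : Set ℝ := {g | g * r < b i} with hA
  set B : Set ℝ := {g | g * r < b j} with hB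
  have hcoord : ∀ g h : ℝ, (∀ k, g * (Pi.single i r : ι → ℝ) k +
      h * (Pi.single j r : ι → ℝ) k < b k) ↔
        (∀ k, k ≠ i → k ≠ j → 0 < b k) ∧ g ∈ A ∧ h ∈ B := by
    intro g h
    refine ⟨fun H => ⟨fun k hi hj => ?_, ?_, ?_⟩, fun ⟨hk, hi, hj⟩ k => ?_⟩
    · simpa [hi, hj] using H k
    · simpa [hij, hA] using H i
    · simpa [hij.symm, hB] using H j
    · by_cases hki : k = i
      · subst hki
        simpa [hij] using hi.out
      by_cases hkj : k = j
      · subst hkj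
        simpa [hki] using hj.out
      simpa [hki, hkj] using hk k hki hkj
  simp only [Pi.add_apply, mul_add, hcoord]
  by_cases hk : ∀ k, k ≠ i → k ≠ j → 0 < b k
  · calc (gaussianReal 0 1).prod (gaussianReal 0 1) {p | (∀ k, k ≠ i → k ≠ j → 0 < b k) ∧
          p.1 ∈ A ∧ p.2 ∈ B}
        ≤ (gaussianReal 0 1).prod (gaussianReal 0 1) (A ×ˢ B) :=
          measure_mono fun p (hp : _ ∧ p.1 ∈ A ∧ p.2 ∈ B) => hp.2
      _ = gaussianReal 0 1 A * gaussianReal 0 1 B := Measure.prod_prod A B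
      _ ≤ gaussianReal 0 1 (A ∩ B) := measure_mul_measure_le_measure_inter <|
          (le_total (b i) (b j)).imp (fun h g hg => lt_of_lt_of_le hg h)
            fun h g hg => lt_of_lt_of_le hg h
      _ ≤ gaussianReal 0 1 {g | (∀ k, k ≠ i → k ≠ j → 0 < b k) ∧ g ∈ A ∧ g ∈ B} :=
          measure_mono fun g hg => ⟨hk, hg⟩
  · simp only [hk, false_and]
    simp

/-- The symmetric matrix with ones at `(i, j)` and `(j, i)`, the direction in which Slepian's
inequality raises one covariance. -/
def pairMatrix (i j : ι) : Matrix ι ι ℝ :=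
  Matrix.single i j 1 + Matrix.single j i 1

omit [Fintype ι] in
lemma vecMulVec_single_sqrt (i j : ι) {θ : ℝ} (hθ : 0 ≤ θ) :
    Matrix.vecMulVec (Pi.single i √θ) (Pi.single j √θ) = θ • Matrix.single i j (1 : ℝ) := by
  have hsingle : ∀ k : ι, (Pi.single k √θ : ι → ℝ) = √θ • Pi.single k 1 := fun k => by
    rw [← Pi.single_smul, smul_eq_mul, mul_one]
  rw [Matrix.single_eq_single_vecMulVec_single, hsingle, hsingle, Matrix.smul_vecMulVec,
    Matrix.vecMulVec_smul, smul_smul, Real.mul_self_sqrt hθ]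

omit [Fintype ι] in
lemma vecMulVec_single_add_single_sqrt (i j : ι) {θ : ℝ} (hθ : 0 ≤ θ) :
    Matrix.vecMulVec (Pi.single i √θ + Pi.single j √θ) (Pi.single i √θ + Pi.single j √θ) =
      θ • (Matrix.single i i (1 : ℝ) + Matrix.single j j 1) + θ • pairMatrix i j := by
  simp only [Matrix.add_vecMulVec, Matrix.vecMulVec_add, vecMulVec_single_sqrt _ _ hθ, pairMatrix]
  module

omit [Fintype ι] in
lemma posSemidef_one_sub_single_sub_single {i j : ι} (hij : i ≠ j) :
    (1 - (Matrix.single i i (1 : ℝ) + Matrix.single j j 1)).PosSemidef := by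
  have hdiag : 1 - (Matrix.single i i (1 : ℝ) + Matrix.single j j 1) =
      Matrix.diagonal fun k => if k = i ∨ k = j then 0 else 1 := by
    ext k l
    by_cases hkl : k = l <;> by_cases hi : k = i <;> by_cases hj : k = j <;>
      simp_all [Matrix.single_apply, Matrix.one_apply, Matrix.diagonal_apply, eq_comm]
  rw [hdiag]
  refine Matrix.PosSemidef.diagonal fun k => ?_
  simp only [Pi.zero_apply]
  split_ifs <;> norm_num

omit [Fintype ι] in
lemma posSemidef_one_add_pairMatrix [Finite ι] {i j : ι} (hij : i ≠ j) :
    (1 + pairMatrix i j).PosSemidef := by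
  have hpsd := posSemidef_vecMulVec_self (Pi.single i √1 + Pi.single j √1 : ι → ℝ)
  rw [vecMulVec_single_add_single_sqrt i j zero_le_one] at hpsd
  convert (posSemidef_one_sub_single_sub_single hij).add hpsd using 1
  module

lemma orthantProb_le_add_smul_pairMatrix (b : ι → ℝ) {S : Matrix ι ι ℝ} {c θ : ℝ} {i j : ι}
    (hij : i ≠ j) (hS : (S - c • (1 : Matrix ι ι ℝ)).PosSemidef) (hθ : 0 ≤ θ) (hθc : θ ≤ c) :
    orthantProb b S ≤ orthantProb b (S + θ • pairMatrix i j) := by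
  have hW : (S - θ • (Matrix.single i i 1 + Matrix.single j j 1)).PosSemidef := by
    convert (hS.add (Matrix.PosSemidef.one.smul (sub_nonneg.2 hθc))).add
      ((posSemidef_one_sub_single_sub_single hij).smul hθ) using 1
    module
  have hnoise := orthantProb_add_le_orthantProb_add b hW
    ((posSemidef_vecMulVec_self _).add (posSemidef_vecMulVec_self _)) (posSemidef_vecMulVec_self _)
    fun b => orthantProb_independent_noise_le_shared_noise b hij √θ
  rw [vecMulVec_single_sqrt _ _ hθ, vecMulVec_single_sqrt _ _ hθ,
    vecMulVec_single_add_single_sqrt _ _ hθ, ← smul_add, ← add_assoc, sub_add_cancel] at hnoise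
  exact hnoise

lemma orthantProb_le_add_sum_smul_pairMatrix (b : ι → ℝ) (s : Finset (ι × ι))
    (hs : ∀ p ∈ s, p.1 ≠ p.2) {θ : ι × ι → ℝ} (hθ : ∀ p ∈ s, 0 ≤ θ p) {S : Matrix ι ι ℝ} {c : ℝ}
    (hS : (S - c • (1 : Matrix ι ι ℝ)).PosSemidef) (hc : ∑ p ∈ s, θ p ≤ c) :
    orthantProb b S ≤ orthantProb b (S + ∑ p ∈ s, θ p • pairMatrix p.1 p.2) := by
  induction s using Finset.induction_on generalizing S c with
  | empty => simp
  | insert p s hps ih =>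
    simp only [Finset.forall_mem_insert] at hs hθ
    rw [Finset.sum_insert hps] at hc
    have hs_nonneg : 0 ≤ ∑ p ∈ s, θ p := Finset.sum_nonneg hθ.2
    have hmargin : (S + θ p • pairMatrix p.1 p.2 - (c - θ p) • (1 : Matrix ι ι ℝ)).PosSemidef := by
      convert hS.add ((posSemidef_one_add_pairMatrix hs.1).smul hθ.1) using 1
      module
    rw [Finset.sum_insert hps, ← add_assoc]
    exact (orthantProb_le_add_smul_pairMatrix b hs.1 hS hθ.1 (by linarith)).trans
      (ih hs.2 hθ.2 hmargin (by linarith))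

lemma sum_offDiag_smul_pairMatrix {D : Matrix ι ι ℝ} (hsymm : D.IsSymm) (hdiag : ∀ i, D i i = 0) :
    ∑ p ∈ (Finset.univ : Finset ι).offDiag, (D p.1 p.2 / 2) • pairMatrix p.1 p.2 = D := by
  have hoff : ∑ p ∈ (Finset.univ : Finset ι).offDiag, (D p.1 p.2 / 2) • pairMatrix p.1 p.2 =
      ∑ p : ι × ι, (D p.1 p.2 / 2) • pairMatrix p.1 p.2 := by
    refine Finset.sum_subset (Finset.subset_univ _) fun p _ hp => ?_
    have hp : p.1 = p.2 := by simpa using hp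
    rw [hp, hdiag, zero_div, zero_smul]
  have hsingle : ∀ M : Matrix ι ι ℝ,
      ∑ p : ι × ι, (M p.1 p.2 / 2) • Matrix.single p.1 p.2 (1 : ℝ) = (1 / 2 : ℝ) • M := by
    intro M
    conv_rhs => rw [Matrix.matrix_eq_sum_single M]
    simp only [Fintype.sum_prod_type, Finset.smul_sum, Matrix.smul_single, smul_eq_mul, mul_one,
      div_eq_inv_mul]
  have hswap : ∑ p : ι × ι, (D p.1 p.2 / 2) • Matrix.single p.2 p.1 (1 : ℝ) =
      (1 / 2 : ℝ) • D := by
    rw [← hsingle D, ← Equiv.sum_comp (Equiv.prodComm ι ι)]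
    exact Finset.sum_congr rfl fun p _ => by simp [hsymm.apply p.1 p.2]
  rw [hoff]
  simp only [pairMatrix, smul_add, Finset.sum_add_distrib]
  rw [hsingle, hswap]
  module

lemma orthantProb_le_of_small_increment (b : ι → ℝ) {S D : Matrix ι ι ℝ} {c : ℝ}
    (hS : (S - c • (1 : Matrix ι ι ℝ)).PosSemidef) (hsymm : D.IsSymm) (hdiag : ∀ i, D i i = 0)
    (hD : ∀ i j, 0 ≤ D i j) (hc : ∑ p ∈ (Finset.univ : Finset ι).offDiag, D p.1 p.2 ≤ c) :
    orthantProb b S ≤ orthantProb b (S + D) := by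
  have hsum : ∑ p ∈ (Finset.univ : Finset ι).offDiag, D p.1 p.2 / 2 ≤ c :=
    (Finset.sum_le_sum fun p _ => half_le_self (hD p.1 p.2)).trans hc
  have hpairs := orthantProb_le_add_sum_smul_pairMatrix b (Finset.univ : Finset ι).offDiag
    (by simp) (fun p _ => div_nonneg (hD p.1 p.2) zero_le_two) hS hsum
  rwa [sum_offDiag_smul_pairMatrix hsymm hdiag] at hpairs

-- The segment from `S` to `T` is traversed in so many steps that each one fits into the margin `c`.
lemma orthantProb_mono_of_nondegenerate (b : ι → ℝ) {S T : Matrix ι ι ℝ} {c : ℝ} (hc : 0 < c)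
    (hS : (S - c • (1 : Matrix ι ι ℝ)).PosSemidef) (hT : (T - c • (1 : Matrix ι ι ℝ)).PosSemidef)
    (hdiag : ∀ i, S i i = T i i) (hle : ∀ i j, S i j ≤ T i j) :
    orthantProb b S ≤ orthantProb b T := by
  have hsymm : (T - S).IsSymm := by
    have h := hT.isHermitian.sub hS.isHermitian
    rwa [sub_sub_sub_cancel_right, Matrix.isHermitian_iff_isSymm] at h
  obtain ⟨m, hm⟩ := exists_nat_gt ((∑ p ∈ (Finset.univ : Finset ι).offDiag, (T - S) p.1 p.2) / c)
  have hm0 : (0 : ℝ) < m := lt_of_le_of_lt (div_nonneg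
    (Finset.sum_nonneg fun p _ => sub_nonneg.2 (hle p.1 p.2)) hc.le) hm
  have hmargin : ∀ k ≤ m, (S + (k / m : ℝ) • (T - S) - c • (1 : Matrix ι ι ℝ)).PosSemidef := by
    intro k hk
    have hkm : (k / m : ℝ) ≤ 1 := div_le_one_of_le₀ (by exact_mod_cast hk) hm0.le
    convert (hS.smul (sub_nonneg.2 hkm)).add (hT.smul (by positivity : (0 : ℝ) ≤ k / m)) using 1
    module
  have hpath : ∀ k ≤ m, orthantProb b S ≤ orthantProb b (S + (k / m : ℝ) • (T - S)) := by
    intro k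
    induction k with
    | zero => simp
    | succ k ih =>
      intro hk
      have hstep : S + ((k + 1 : ℕ) / m : ℝ) • (T - S) =
          S + (k / m : ℝ) • (T - S) + (1 / m : ℝ) • (T - S) := by
        push_cast
        module
      rw [hstep]
      refine (ih (by omega)).trans (orthantProb_le_of_small_increment b (hmargin k (by omega))
        (hsymm.smul _) (fun i => by simp [hdiag i]) (fun i j => ?_) ?_)
      · exact mul_nonneg (by positivity) (sub_nonneg.2 (hle i j))
      · simp only [Matrix.smul_apply, smul_eq_mul, ← Finset.mul_sum]
        rw [div_lt_iff₀ hc] at hm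
        rw [one_div, inv_mul_le_iff₀ hm0]
        exact hm.le
  have hend := hpath m le_rfl
  rwa [div_self hm0.ne', one_smul, add_sub_cancel] at hend

lemma orthantProb_add_sq_smul_one (b : ι → ℝ) {S : Matrix ι ι ℝ} (hS : S.PosSemidef) (c : ℝ) :
    orthantProb b (S + c ^ 2 • (1 : Matrix ι ι ℝ)) =
      ((multivariateGaussian 0 S).prod (stdGaussian (EuclideanSpace ℝ ι)))
        {p | ∀ i, p.1 i + c * p.2 i < b i} := by
  have hconv := multivariateGaussian_conv_multivariateGaussian 0 0 hS
    (Matrix.PosSemidef.one.smul (sq_nonneg c))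
  have hsnd := Measure.map_prod_map (multivariateGaussian 0 S) (stdGaussian (EuclideanSpace ℝ ι))
    measurable_id (measurable_const_smul c)
  rw [Measure.map_id, map_smul_stdGaussian] at hsnd
  rw [zero_add] at hconv
  rw [orthantProb, ← hconv, Measure.conv, hsnd, Measure.map_map (by fun_prop) (by fun_prop),
    Measure.map_apply (by fun_prop) (measurableSet_orthant b)]
  rfl

lemma ae_eval_ne_multivariateGaussian {S : Matrix ι ι ℝ} (hS : S.PosSemidef) {i : ι}
    (hi : 0 < S i i) (a : ℝ) : ∀ᵐ x ∂multivariateGaussian 0 S, x i ≠ a := by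
  have := nullSingletonClass_gaussianReal (μ := 0) (v := (S i i).toNNReal) (by simpa using hi)
  have hne : ∀ᵐ y ∂gaussianReal 0 (S i i).toNNReal, y ≠ a := by
    rw [ae_iff]
    simp
  exact (measurePreserving_eval_multivariateGaussian (μ := 0) hS).quasiMeasurePreserving.ae hne

omit [Fintype ι] [DecidableEq ι] in
lemma eventually_forall_lt_iff [Finite ι] {α : Type*} {l : Filter α} {y : α → ι → ℝ}
    {x b : ι → ℝ} (hy : ∀ i, Tendsto (fun a => y a i) l (𝓝 (x i))) (hne : ∀ i, x i ≠ b i) :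
    ∀ᶠ a in l, (∀ i, y a i < b i) ↔ ∀ i, x i < b i := by
  by_cases hlt : ∀ i, x i < b i
  · filter_upwards [eventually_all.2 fun i => (hy i).eventually_lt_const (hlt i)] with a ha
    exact iff_of_true ha hlt
  · push Not at hlt
    obtain ⟨i, hi⟩ := hlt
    filter_upwards [(hy i).eventually_const_lt (lt_of_le_of_ne hi (hne i).symm)] with a ha
    exact iff_of_false (fun h => (h i).not_gt ha) (fun h => (h i).not_ge hi)

lemma tendsto_orthantProb_add_sq_smul_one (b : ι → ℝ) {S : Matrix ι ι ℝ} (hS : S.PosSemidef)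
    (hpos : ∀ i, 0 < S i i) :
    Tendsto (fun c : ℝ => orthantProb b (S + c ^ 2 • (1 : Matrix ι ι ℝ))) (𝓝 0)
      (𝓝 (orthantProb b S)) := by
  have hmeas : ∀ c : ℝ, MeasurableSet {p : EuclideanSpace ℝ ι × EuclideanSpace ℝ ι |
      ∀ i, p.1 i + c * p.2 i < b i} := fun c => by
    rw [Set.ofPred_forall]
    exact MeasurableSet.iInter fun i => measurableSet_lt (by fun_prop) measurable_const
  have hzero := orthantProb_add_sq_smul_one b hS 0
  rw [zero_pow two_ne_zero, zero_smul, add_zero] at hzero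
  simp_rw [orthantProb_add_sq_smul_one b hS, hzero]
  refine tendsto_measure_of_ae_tendsto_indicator_of_isFiniteMeasure _ (hmeas 0) hmeas ?_
  have hne : ∀ᵐ p ∂(multivariateGaussian 0 S).prod (stdGaussian (EuclideanSpace ℝ ι)),
      ∀ i, p.1 i ≠ b i :=
    ae_all_iff.2 fun i => Measure.quasiMeasurePreserving_fst.ae
      (ae_eval_ne_multivariateGaussian hS (hpos i) (b i))
  filter_upwards [hne] with p hp
  refine eventually_forall_lt_iff (fun i => ?_) fun i => by simpa using hp i
  exact (continuous_const.add (continuous_id.mul continuous_const)).tendsto 0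

lemma orthantProb_mono (b : ι → ℝ) {S T : Matrix ι ι ℝ} (hS : S.PosSemidef) (hT : T.PosSemidef)
    (hpos : ∀ i, 0 < S i i) (hdiag : ∀ i, S i i = T i i) (hle : ∀ i j, S i j ≤ T i j) :
    orthantProb b S ≤ orthantProb b T := by
  refine le_of_tendsto_of_tendsto
    ((tendsto_orthantProb_add_sq_smul_one b hS hpos).mono_left (nhdsWithin_le_nhds (s := {0}ᶜ)))
    ((tendsto_orthantProb_add_sq_smul_one b hT fun i => hdiag i ▸ hpos i).mono_left
      nhdsWithin_le_nhds) ?_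
  filter_upwards [self_mem_nhdsWithin] with c (hc : c ≠ 0)
  exact orthantProb_mono_of_nondegenerate b (by positivity : 0 < c ^ 2) (by simpa using hS)
    (by simpa using hT) (by simpa using hdiag) (by simpa using hle)

omit [Fintype ι] [DecidableEq ι] in
theorem measure_lt_le_measure_lt_of_covariance_le [Finite ι] {Ω Ω' : Type*} [MeasurableSpace Ω]
    [MeasurableSpace Ω'] {P : Measure Ω} {P' : Measure Ω'} {X : ι → Ω → ℝ} {Y : ι → Ω' → ℝ}
    (hX : HasGaussianLaw (fun ω i => X i ω) P) (hY : HasGaussianLaw (fun ω i => Y i ω) P')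
    (hX_mean : ∀ i, P[X i] = 0) (hY_mean : ∀ i, P'[Y i] = 0) (hpos : ∀ i, 0 < Var[X i; P])
    (hvar : ∀ i, Var[X i; P] = Var[Y i; P'])
    (hcov : ∀ i j, cov[X i, X j; P] ≤ cov[Y i, Y j; P']) (b : ι → ℝ) :
    P {ω | ∀ i, X i ω < b i} ≤ P' {ω | ∀ i, Y i ω < b i} := by
  classical
  have := Fintype.ofFinite ι
  have := hX.isProbabilityMeasure
  have := hY.isProbabilityMeasure
  have hX_self : ∀ i, cov[X i, X i; P] = Var[X i; P] := fun i =>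
    covariance_self (hX.eval i).aemeasurable
  have hY_self : ∀ i, cov[Y i, Y i; P'] = Var[Y i; P'] := fun i =>
    covariance_self (hY.eval i).aemeasurable
  rw [measure_lt_eq_orthantProb hX hX_mean, measure_lt_eq_orthantProb hY hY_mean]
  refine orthantProb_mono b (posSemidef_covarianceMatrix fun i => (hX.eval i).memLp_two)
    (posSemidef_covarianceMatrix fun i => (hY.eval i).memLp_two) (fun i => ?_) (fun i => ?_) hcov
  · exact (hpos i).trans_eq (hX_self i).symm
  · exact (hX_self i).trans ((hvar i).trans (hY_self i).symm)

end Slepian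

/-! ### Gaussian random walks killed on leaving the negative half-line -/

section Walk

lemma map_update_infinitePi {ι : Type*} [DecidableEq ι] {X : ι → Type*}
    [∀ i, MeasurableSpace (X i)] (μ : ∀ i, Measure (X i)) [∀ i, IsProbabilityMeasure (μ i)]
    (k : ι) :
    ((Measure.infinitePi μ).prod (μ k)).map (fun p => Function.update p.1 k p.2) =
      Measure.infinitePi μ := by
  refine Measure.eq_infinitePi _ fun s t ht => ?_
  rw [Measure.map_apply measurable_update' (MeasurableSet.pi s.countable_toSet fun i _ => ht i)]
  have hpre : (fun p : (∀ i, X i) × X k => Function.update p.1 k p.2) ⁻¹' Set.pi s t =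
      (Set.pi (s.erase k : Finset ι) t) ×ˢ (if k ∈ s then t k else Set.univ) := by
    ext p
    simp only [Set.mem_preimage, Set.mem_pi, Finset.mem_coe, Set.mem_prod, Finset.mem_erase]
    constructor
    · intro h
      refine ⟨fun i hi => by simpa [hi.1] using h i hi.2, ?_⟩
      split_ifs with hk
      · simpa using h k hk
      · trivial
    · rintro ⟨hne, hself⟩ i hi
      by_cases hik : i = k
      · subst hik; simpa [hi] using hself
      · simpa [hik] using hne i ⟨hik, hi⟩
  rw [hpre, Measure.prod_prod, Measure.infinitePi_pi _ fun i _ => ht i]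
  split_ifs with hk
  · rw [Finset.prod_erase_mul _ _ hk]
  · rw [Finset.erase_eq_of_notMem hk, measure_univ, mul_one]

/-- The law of a sequence of independent standard Gaussian variables. -/
noncomputable def stdSeq : Measure (ℕ → ℝ) := Measure.infinitePi fun _ => gaussianReal 0 1

instance : IsProbabilityMeasure stdSeq := by unfold stdSeq; infer_instance

/-- The position at time `k` of the walk with increments `c 0 * x 0, c 1 * x 1, …`; under `stdSeq`
these are independent centred Gaussian variables of variance `c i ^ 2`. -/
def walk (c : ℕ → ℝ) (k : ℕ) (x : ℕ → ℝ) : ℝ := ∑ i ∈ Finset.range k, c i * x i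

/-- The event that the walk is negative at the times `1, …, k`. -/
def walkNeg (c : ℕ → ℝ) (k : ℕ) : Set (ℕ → ℝ) := {x | ∀ l < k, walk c (l + 1) x < 0}

/-- The standard deviation of the walk at time `k`. -/
noncomputable def walkSd (c : ℕ → ℝ) (k : ℕ) : ℝ := √(∑ i ∈ Finset.range k, c i ^ 2)

/-- The transition operator of the killed walk: the expectation of `h` at the position reached from
`x` by a centred Gaussian step of standard deviation `c`, the walk being killed unless this position
is negative. -/
noncomputable def killedStep (c : ℝ) (h : ℝ → ℝ≥0∞) (x : ℝ) : ℝ≥0∞ :=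
  ∫⁻ w in Set.Iio 0, h w ∂gaussianReal x (.mk (c ^ 2) (sq_nonneg c))

@[fun_prop]
lemma measurable_walk (c : ℕ → ℝ) (k : ℕ) : Measurable (walk c k) := by
  unfold walk; fun_prop

@[simp]
lemma walk_zero (c : ℕ → ℝ) (x : ℕ → ℝ) : walk c 0 x = 0 := by simp [walk]

@[simp]
lemma walkNeg_zero (c : ℕ → ℝ) : walkNeg c 0 = Set.univ := by simp [walkNeg]

lemma measurableSet_walkNeg (c : ℕ → ℝ) (k : ℕ) : MeasurableSet (walkNeg c k) := by
  simp only [walkNeg, Set.ofPred_forall]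
  exact MeasurableSet.iInter fun l => MeasurableSet.iInter fun _ =>
    measurableSet_lt (measurable_walk c _) measurable_const

lemma walkSd_sq (c : ℕ → ℝ) (k : ℕ) : walkSd c k ^ 2 = ∑ i ∈ Finset.range k, c i ^ 2 :=
  Real.sq_sqrt (Finset.sum_nonneg fun _ _ => sq_nonneg _)

lemma walkSd_pos {c : ℕ → ℝ} (hc : 0 < c 0) (k : ℕ) : 0 < walkSd c (k + 1) :=
  Real.sqrt_pos.2 (Finset.sum_pos' (fun _ _ => sq_nonneg _) ⟨0, by simp, by positivity⟩)

lemma walkSd_one {c : ℕ → ℝ} (hc : 0 ≤ c 0) : walkSd c 1 = c 0 := by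
  simp [walkSd, Real.sqrt_sq hc]

lemma walk_update_of_le (c : ℕ → ℝ) {k l : ℕ} (hl : l ≤ k) (x : ℕ → ℝ) (y : ℝ) :
    walk c l (Function.update x k y) = walk c l x :=
  Finset.sum_congr rfl fun i hi => by
    rw [Function.update_of_ne (by have := Finset.mem_range.1 hi; omega)]

lemma walk_succ_update (c : ℕ → ℝ) (k : ℕ) (x : ℕ → ℝ) (y : ℝ) :
    walk c (k + 1) (Function.update x k y) = walk c k x + c k * y := by
  rw [← walk_update_of_le c le_rfl x y]
  simp [walk, Finset.sum_range_succ]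

lemma update_mem_walkNeg_succ (c : ℕ → ℝ) (k : ℕ) (x : ℕ → ℝ) (y : ℝ) :
    Function.update x k y ∈ walkNeg c (k + 1) ↔ x ∈ walkNeg c k ∧ walk c k x + c k * y < 0 := by
  simp only [walkNeg, Set.mem_ofPred_eq, Nat.forall_lt_succ_right, walk_succ_update]
  refine and_congr_left fun _ => forall₂_congr fun l hl => ?_
  rw [walk_update_of_le c hl]

lemma gaussianReal_map_const_add_const_mul (x c : ℝ) :
    (gaussianReal 0 1).map (fun y => x + c * y) = gaussianReal x (.mk (c ^ 2) (sq_nonneg c)) := by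
  change (gaussianReal 0 1).map ((x + ·) ∘ (c * ·)) = _
  rw [← Measure.map_map (by fun_prop) (by fun_prop), gaussianReal_map_const_mul,
    gaussianReal_map_const_add]
  simp

lemma killedStep_eq_lintegral (c : ℝ) {h : ℝ → ℝ≥0∞} (hh : Measurable h) (x : ℝ) :
    killedStep c h x = ∫⁻ y, (Set.Iio 0).indicator h (x + c * y) ∂gaussianReal 0 1 := by
  rw [killedStep, ← lintegral_indicator measurableSet_Iio, ← gaussianReal_map_const_add_const_mul,
    lintegral_map (hh.indicator measurableSet_Iio) (by fun_prop)]

/-- The Markov property of the killed walk. -/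
lemma setLIntegral_walkNeg_succ (c : ℕ → ℝ) (k : ℕ) {h : ℝ → ℝ≥0∞} (hh : Measurable h) :
    ∫⁻ x in walkNeg c (k + 1), h (walk c (k + 1) x) ∂stdSeq =
      ∫⁻ x in walkNeg c k, killedStep (c k) h (walk c k x) ∂stdSeq := by
  have hm : Measurable ((walkNeg c (k + 1)).indicator fun x => h (walk c (k + 1) x)) :=
    (hh.comp (measurable_walk c _)).indicator (measurableSet_walkNeg c _)
  rw [← lintegral_indicator (measurableSet_walkNeg c _),
    ← lintegral_indicator (measurableSet_walkNeg c _)]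
  conv_lhs => rw [stdSeq, ← map_update_infinitePi _ k, ← stdSeq]
  rw [lintegral_map hm measurable_update', lintegral_prod]
  swap
  · exact (hm.comp measurable_update').aemeasurable
  classical
  refine lintegral_congr fun x => ?_
  by_cases hx : x ∈ walkNeg c k
  · rw [Set.indicator_of_mem hx, killedStep_eq_lintegral _ hh]
    refine lintegral_congr fun y => ?_
    simp [Set.indicator_apply, update_mem_walkNeg_succ, hx, walk_succ_update]
  · simp [update_mem_walkNeg_succ, hx]

lemma setLIntegral_walkNeg_one (c : ℕ → ℝ) {h : ℝ → ℝ≥0∞} (hh : Measurable h) :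
    ∫⁻ x in walkNeg c 1, h (walk c 1 x) ∂stdSeq = killedStep (c 0) h 0 := by
  simp [setLIntegral_walkNeg_succ c 0 hh]

lemma walk_neg_of_mem_walkNeg_succ {c : ℕ → ℝ} {k : ℕ} {x : ℕ → ℝ} (hx : x ∈ walkNeg c (k + 1)) :
    walk c (k + 1) x < 0 := hx k k.lt_succ_self

end Walk

section Kill

variable {v : ℝ≥0}

lemma gaussianReal_real_pos (μ : ℝ) (hv : v ≠ 0) {U : Set ℝ} (hU : IsOpen U) (hne : U.Nonempty) :
    0 < (gaussianReal μ v).real U := by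
  refine ENNReal.toReal_pos (fun hnull => ?_) (measure_ne_top _ _)
  exact (hU.measure_pos volume hne).ne' (gaussianReal_absolutelyContinuous' μ hv hnull)

lemma integrable_gaussianPDFReal_mul {μ : ℝ} (hv : v ≠ 0) {f : ℝ → ℝ}
    (hf : Integrable f (gaussianReal μ v)) : Integrable (fun w => gaussianPDFReal μ v w * f w) := by
  rw [gaussianReal_of_var_ne_zero _ hv, integrable_withDensity_iff_integrable_smul'
    (measurable_gaussianPDF _ _) (ae_of_all _ fun _ => gaussianPDF_lt_top)] at hf
  simpa [toReal_gaussianPDF] using hf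

lemma setIntegral_gaussianReal (μ : ℝ) (hv : v ≠ 0) (f : ℝ → ℝ) {s : Set ℝ}
    (hs : MeasurableSet s) :
    ∫ w in s, f w ∂gaussianReal μ v = ∫ w in s, gaussianPDFReal μ v w * f w := by
  rw [gaussianReal_of_var_ne_zero _ hv, setIntegral_withDensity_eq_setIntegral_toReal_smul
    (measurable_gaussianPDF _ _) (ae_of_all _ fun _ => gaussianPDF_lt_top) _ hs]
  simp [toReal_gaussianPDF]

lemma hasDerivAt_gaussianPDFReal (μ : ℝ) (hv : v ≠ 0) (w : ℝ) :
    HasDerivAt (gaussianPDFReal μ v) (-((w - μ) / v) * gaussianPDFReal μ v w) w := by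
  have hexp : HasDerivAt (fun w => -(w - μ) ^ 2 / (2 * v)) (-(2 * (w - μ)) / (2 * v)) w := by
    simpa using ((((hasDerivAt_id w).sub_const μ).pow 2).neg.div_const (2 * (v : ℝ)))
  rw [gaussianPDFReal_def]
  refine (hexp.exp.const_mul _).congr_deriv ?_
  simp only
  field_simp

/-- Stein's identity for the function `max w 0`. -/
lemma setIntegral_Ioi_stein (x : ℝ) (hv : v ≠ 0) :
    ∫ w in Set.Ioi 0, (v - w * (w - x)) ∂gaussianReal x v = 0 := by
  have hid : MemLp (fun w : ℝ => w) 2 (gaussianReal x v) := memLp_id_gaussianReal 2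
  have hint : Integrable (fun w => gaussianPDFReal x v w * (1 - w * (w - x) / v)) := by
    refine integrable_gaussianPDFReal_mul hv ((integrable_const _).sub (Integrable.div_const ?_ _))
    exact hid.integrable_mul (hid.sub (memLp_const x))
  have hderiv : ∀ w ∈ Set.Ici (0 : ℝ), HasDerivAt (fun w => gaussianPDFReal x v w * w)
      (gaussianPDFReal x v w * (1 - w * (w - x) / v)) w := fun w _ => by
    refine ((hasDerivAt_gaussianPDFReal x hv w).mul (hasDerivAt_id w)).congr_deriv ?_
    simp only [id_eq]
    ring
  have hlim := tendsto_zero_of_hasDerivAt_of_integrableOn_Ioi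
    (fun w hw => hderiv w (Set.Ioi_subset_Ici_self hw)) hint.integrableOn
    (integrable_gaussianPDFReal_mul hv (hid.integrable one_le_two)).integrableOn
  have hFTC := integral_Ioi_of_hasDerivAt_of_tendsto' hderiv hint.integrableOn hlim
  rw [← setIntegral_gaussianReal x hv _ measurableSet_Ioi] at hFTC
  have hv0 : (v : ℝ) ≠ 0 := by exact_mod_cast hv
  calc ∫ w in Set.Ioi 0, (v - w * (w - x)) ∂gaussianReal x v
      = v * ∫ w in Set.Ioi 0, (1 - w * (w - x) / v) ∂gaussianReal x v := by
        rw [← integral_const_mul]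
        refine integral_congr_ae (ae_of_all _ fun w => ?_)
        field_simp
    _ = 0 := by rw [hFTC]; simp

lemma setIntegral_Ioi_id_gaussianReal_le {x : ℝ} (hx : x ≤ 0) (hv : v ≠ 0) :
    ∫ w in Set.Ioi 0, w ∂gaussianReal x v ≤ √v * (gaussianReal x v).real (Set.Ioi 0) := by
  have hid : MemLp (fun w : ℝ => w) 2 (gaussianReal x v) := memLp_id_gaussianReal 2
  have hid1 : Integrable (fun w : ℝ => w) (gaussianReal x v) := hid.integrable one_le_two
  have hv0 : (0 : ℝ) < √v := Real.sqrt_pos.2 (by positivity)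
  have hsq : √(v : ℝ) ^ 2 = v := Real.sq_sqrt v.coe_nonneg
  have hle : ∫ w in Set.Ioi 0, (v - w * (w - x)) ∂gaussianReal x v ≤
      ∫ w in Set.Ioi 0, (2 * √v - x) * (√v - w) ∂gaussianReal x v := by
    refine integral_mono ?_ ?_ fun w => ?_
    · exact ((integrable_const _).sub (hid.integrable_mul (hid.sub (memLp_const x)))).integrableOn
    · exact (((integrable_const _).sub hid1).const_mul _).integrableOn
    · simp only
      nlinarith [sq_nonneg (w - √v), mul_nonneg (neg_nonneg.2 hx) hv0.le]
  rw [setIntegral_Ioi_stein x hv, integral_const_mul] at hle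
  have hnonneg := nonneg_of_mul_nonneg_right hle (by linarith)
  rw [integral_sub (integrable_const _) hid1.integrableOn, setIntegral_const, smul_eq_mul]
    at hnonneg
  linarith

lemma killedStep_sub_le {c x β : ℝ} (hc : 0 < c) (hx : x ≤ 0) (hβ : 2 * c ≤ β) :
    killedStep c (fun w => ENNReal.ofReal (β - w)) x ≤
      ENNReal.ofReal (β - x - c * (gaussianReal 0 1).real (Set.Ioi (-x / c))) := by
  set N := gaussianReal x (.mk (c ^ 2) (sq_nonneg c)) with hN
  have hv : NNReal.mk (c ^ 2) (sq_nonneg c) ≠ 0 := by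
    rw [← NNReal.coe_ne_zero]; exact (pow_pos hc 2).ne'
  have hid : Integrable (fun w : ℝ => w) N := (memLp_id_gaussianReal 1).integrable le_rfl
  have hsub : Integrable (fun w => β - w) N := (integrable_const β).sub hid
  have htail : N.real (Set.Ioi 0) = (gaussianReal 0 1).real (Set.Ioi (-x / c)) := by
    rw [hN, ← gaussianReal_map_const_add_const_mul,
      map_measureReal_apply (by fun_prop) measurableSet_Ioi]
    congr 1
    ext y
    simp [div_lt_iff₀ hc, neg_lt_iff_pos_add', mul_comm]
  have hexcess : ∫ w in Set.Ioi 0, w ∂N ≤ c * N.real (Set.Ioi 0) := by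
    simpa [Real.sqrt_sq hc.le] using setIntegral_Ioi_id_gaussianReal_le hx hv
  have htotal : ∫ w in Set.Iic 0, (β - w) ∂N + ∫ w in Set.Ioi 0, (β - w) ∂N = β - x := by
    rw [← Set.compl_Iic, integral_add_compl measurableSet_Iic hsub,
      integral_sub (integrable_const _) hid, integral_id_gaussianReal]
    simp
  have hIoi : ∫ w in Set.Ioi 0, (β - w) ∂N = N.real (Set.Ioi 0) * β - ∫ w in Set.Ioi 0, w ∂N := by
    rw [integral_sub (integrable_const _) hid.integrableOn, setIntegral_const, smul_eq_mul]
  calc killedStep c (fun w => ENNReal.ofReal (β - w)) x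
      ≤ ∫⁻ w in Set.Iic 0, ENNReal.ofReal (β - w) ∂N :=
        lintegral_mono_set Set.Iio_subset_Iic_self
    _ = ENNReal.ofReal (∫ w in Set.Iic 0, (β - w) ∂N) :=
        (ofReal_integral_eq_lintegral_ofReal hsub.integrableOn
          ((ae_restrict_mem measurableSet_Iic).mono fun w (hw : w ≤ 0) => by
            simp only [Pi.zero_apply]; linarith)).symm
    _ ≤ _ := ENNReal.ofReal_le_ofReal (by
        rw [← htail]
        nlinarith [measureReal_nonneg (μ := N) (s := Set.Ioi 0)])

/-- Far from the origin the growth is paid for by the size of `x`, close to the origin by the chance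
of being killed. -/
lemma killedStep_sub_le_mul {c x τ τ' a δ : ℝ} (hc : 0 < c) (hx : x ≤ 0) (hτ : 0 < τ)
    (hτ' : 0 ≤ τ') (hττ' : τ' ^ 2 = τ ^ 2 + c ^ 2) (hδ : 0 < δ) (ha : 0 < a) (hcτ : c ≤ a * τ)
    (hQ : a ^ 2 ≤ (gaussianReal 0 1).real (Set.Ioi (1 / δ))) :
    killedStep c (fun w => ENNReal.ofReal (2 * a * τ' - w)) x ≤
      ENNReal.ofReal (1 + δ * a ^ 2) * ENNReal.ofReal (2 * a * τ - x) := by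
  have hlt : τ ≤ τ' := abs_le_of_sq_le_sq' (by nlinarith) hτ' |>.2
  grw [killedStep_sub_le hc hx (by nlinarith), ← ENNReal.ofReal_mul (by positivity)]
  refine ENNReal.ofReal_le_ofReal ?_
  set Q := (gaussianReal 0 1).real (Set.Ioi (-x / c))
  have hQ0 : 0 ≤ Q := measureReal_nonneg
  have hgrowth : 2 * a * τ' ≤ 2 * a * τ + c * a ^ 2 := by
    have : τ' ≤ τ + c * a / 2 :=
      abs_le_of_sq_le_sq' (by nlinarith [sq_nonneg (c * a)]) (by positivity) |>.2
    nlinarith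
  have hpay : c * a ^ 2 ≤ c * Q + δ * a ^ 2 * (2 * a * τ - x) := by
    have hτδ : 0 ≤ δ * a ^ 2 * (2 * a * τ) := by positivity
    rcases le_total (1 / δ) (-x / c) with hfar | hnear
    · rw [div_le_div_iff₀ hδ hc, one_mul] at hfar
      nlinarith [mul_le_mul_of_nonneg_left hfar (sq_nonneg a), mul_nonneg hc.le hQ0]
    · have : a ^ 2 ≤ Q := hQ.trans (measureReal_mono (Set.Ioi_subset_Ioi hnear))
      have : 0 ≤ δ * a ^ 2 * -x := mul_nonneg (by positivity) (neg_nonneg.2 hx)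
      nlinarith
  linarith

end Kill

section WalkUpper

variable {c : ℕ → ℝ} {a δ : ℝ}

lemma setLIntegral_walkNeg_sub_le (hc : ∀ k, 0 < c k) (hδ : 0 < δ) (ha : 0 < a)
    (hcsd : ∀ k, c (k + 1) ≤ a * walkSd c (k + 1))
    (hQ : a ^ 2 ≤ (gaussianReal 0 1).real (Set.Ioi (1 / δ))) (n : ℕ) :
    ∫⁻ x in walkNeg c (n + 1), ENNReal.ofReal (2 * a * walkSd c (n + 1) - walk c (n + 1) x)
        ∂stdSeq ≤
      ENNReal.ofReal ((1 + δ * a ^ 2) ^ n * (2 * (1 + a) * c 0)) := by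
  have hm : ∀ k, Measurable fun w => ENNReal.ofReal (2 * a * walkSd c k - w) :=
    fun k => by fun_prop
  have hc0 := hc 0
  induction n with
  | zero =>
    have hQ0 : 0 ≤ (gaussianReal 0 1).real (Set.Ioi (-0 / c 0)) := measureReal_nonneg
    calc _ = killedStep (c 0) (fun w => ENNReal.ofReal (2 * a * c 0 - w)) 0 := by
          rw [setLIntegral_walkNeg_one c (hm _), zero_add, walkSd_one hc0.le]
      _ ≤ killedStep (c 0) (fun w => ENNReal.ofReal (2 * (1 + a) * c 0 - w)) 0 :=
          lintegral_mono fun w => ENNReal.ofReal_le_ofReal (by linarith)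
      _ ≤ _ := killedStep_sub_le hc0 le_rfl (by nlinarith)
      _ ≤ _ := ENNReal.ofReal_le_ofReal (by nlinarith)
  | succ n ih =>
    have hstep : ∀ x ∈ walkNeg c (n + 1), killedStep (c (n + 1))
        (fun w => ENNReal.ofReal (2 * a * walkSd c (n + 1 + 1) - w)) (walk c (n + 1) x) ≤
        ENNReal.ofReal (1 + δ * a ^ 2) *
          ENNReal.ofReal (2 * a * walkSd c (n + 1) - walk c (n + 1) x) := fun x hx =>
      killedStep_sub_le_mul (hc _) (walk_neg_of_mem_walkNeg_succ hx).le (walkSd_pos hc0 _)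
        (walkSd_pos hc0 _).le (by simp only [walkSd_sq, Finset.sum_range_succ]) hδ ha (hcsd n) hQ
    rw [setLIntegral_walkNeg_succ c (n + 1) (hm _)]
    grw [setLIntegral_mono' (measurableSet_walkNeg c _) hstep,
      lintegral_const_mul' _ _ ENNReal.ofReal_ne_top, ih, ← ENNReal.ofReal_mul (by positivity)]
    rw [← mul_assoc, pow_succ' (1 + _)]

lemma stdSeq_real_walkNeg_le (hc : ∀ k, 0 < c k) (hδ : 0 < δ) (ha : 0 < a)
    (hcsd : ∀ k, c (k + 1) ≤ a * walkSd c (k + 1))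
    (hQ : a ^ 2 ≤ (gaussianReal 0 1).real (Set.Ioi (1 / δ))) (n : ℕ) :
    stdSeq.real (walkNeg c (n + 1)) ≤
      (1 + δ * a ^ 2) ^ n * ((1 + a) * c 0) / (a * walkSd c (n + 1)) := by
  have hc0 := hc 0
  have hsd := walkSd_pos hc0 n
  have hle : ENNReal.ofReal (2 * a * walkSd c (n + 1)) * stdSeq (walkNeg c (n + 1)) ≤
      ENNReal.ofReal ((1 + δ * a ^ 2) ^ n * (2 * (1 + a) * c 0)) := by
    refine le_trans ?_ (setLIntegral_walkNeg_sub_le hc hδ ha hcsd hQ n)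
    rw [← setLIntegral_const]
    refine setLIntegral_mono' (measurableSet_walkNeg c _) fun x hx => ENNReal.ofReal_le_ofReal ?_
    linarith [walk_neg_of_mem_walkNeg_succ hx]
  have hle_real := ENNReal.toReal_mono ENNReal.ofReal_ne_top hle
  rw [ENNReal.toReal_mul, ENNReal.toReal_ofReal (by positivity),
    ENNReal.toReal_ofReal (by positivity), ← measureReal_def] at hle_real
  rw [le_div_iff₀ (by positivity)]
  linarith

end WalkUpper

section WalkLower

/-- For `w < 0` this is, by the reflection principle, the probability that a Brownian motion started
at `w` stays negative up to time `V`; it is extended to an odd function of `w`. -/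
noncomputable def brownianSurvival (V : ℝ≥0) (w : ℝ) : ℝ :=
  (gaussianReal w V).real (Set.Iio 0) - (gaussianReal w V).real (Set.Ioi 0)

lemma gaussianReal_real_Iio_zero (V : ℝ≥0) (w : ℝ) :
    (gaussianReal w V).real (Set.Iio 0) = (gaussianReal 0 V).real (Set.Iio (-w)) := by
  rw [← zero_add w, ← gaussianReal_map_add_const, map_measureReal_apply (by fun_prop)
    measurableSet_Iio]
  congr 1; ext y; simp [lt_neg_iff_add_neg]

lemma gaussianReal_real_Ioi_zero (V : ℝ≥0) (w : ℝ) :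
    (gaussianReal w V).real (Set.Ioi 0) = (gaussianReal 0 V).real (Set.Iio w) := by
  rw [← neg_neg w, ← gaussianReal_real_Iio_zero, neg_neg, ← gaussianReal_map_neg,
    map_measureReal_apply measurable_neg measurableSet_Iio]
  congr 1; ext y; simp

lemma brownianSurvival_eq (V : ℝ≥0) (w : ℝ) : brownianSurvival V w =
    (gaussianReal 0 V).real (Set.Iio (-w)) - (gaussianReal 0 V).real (Set.Iio w) := by
  rw [brownianSurvival, gaussianReal_real_Iio_zero, gaussianReal_real_Ioi_zero]

lemma antitone_brownianSurvival (V : ℝ≥0) : Antitone (brownianSurvival V) := fun w w' h => by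
  simp only [brownianSurvival_eq]
  exact sub_le_sub (measureReal_mono (Set.Iio_subset_Iio (neg_le_neg h)))
    (measureReal_mono (Set.Iio_subset_Iio h))

@[simp]
lemma brownianSurvival_zero (V : ℝ≥0) : brownianSurvival V 0 = 0 := by simp [brownianSurvival_eq]

lemma brownianSurvival_le_one (V : ℝ≥0) (w : ℝ) : brownianSurvival V w ≤ 1 :=
  (sub_le_self _ measureReal_nonneg).trans measureReal_le_one

lemma le_brownianSurvival {V : ℝ≥0} (hV : V ≠ 0) {z : ℝ} (hz : 0 ≤ z) (hzV : z ^ 2 ≤ V) :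
    2 * Real.exp (-(1 / 2)) / √(2 * Real.pi) * (z / √V) ≤ brownianSurvival V (-z) := by
  have hpdf : ∀ y ∈ Set.Ico (-z) z,
      Real.exp (-(1 / 2)) / √(2 * Real.pi * V) ≤ gaussianPDFReal 0 V y := fun y hy => by
    rw [gaussianPDFReal, div_eq_inv_mul]
    refine mul_le_mul_of_nonneg_left (Real.exp_le_exp.2 ?_) (by positivity)
    have : y ^ 2 ≤ z ^ 2 := sq_le_sq' hy.1 hy.2.le
    rw [sub_zero, neg_div, neg_le_neg_iff, div_le_div_iff₀ (by positivity) two_pos]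
    linarith
  calc 2 * Real.exp (-(1 / 2)) / √(2 * Real.pi) * (z / √V)
      = ∫ _ in Set.Ico (-z) z, Real.exp (-(1 / 2)) / √(2 * Real.pi * V) := by
        rw [setIntegral_const, Real.volume_real_Ico_of_le (by linarith), smul_eq_mul,
          Real.sqrt_mul (by positivity : 0 ≤ 2 * Real.pi)]
        ring
    _ ≤ ∫ y in Set.Ico (-z) z, gaussianPDFReal 0 V y :=
        setIntegral_mono_on (integrable_const _) (integrable_gaussianPDFReal _ _).integrableOn
          measurableSet_Ico hpdf
    _ = (gaussianReal 0 V).real (Set.Ico (-z) z) := by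
        rw [measureReal_def, gaussianReal_apply_eq_integral _ hV,
          ENNReal.toReal_ofReal (integral_nonneg fun y => gaussianPDFReal_nonneg _ _ _)]
    _ = brownianSurvival V (-z) := by
        have hdiff : Set.Iio z \ Set.Iio (-z) = Set.Ico (-z) z := by
          ext y; simp [and_comm]
        rw [brownianSurvival_eq, neg_neg, ← hdiff,
          measureReal_sdiff (Set.Iio_subset_Iio (by linarith)) measurableSet_Iio]

lemma lintegral_gaussianReal_apply (x : ℝ) (v V : ℝ≥0) {A : Set ℝ} (hA : MeasurableSet A) :
    ∫⁻ w, gaussianReal w V A ∂gaussianReal x v = gaussianReal x (v + V) A := by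
  have hconv : gaussianReal x (v + V) = gaussianReal x v ∗ gaussianReal 0 V := by
    rw [gaussianReal_conv_gaussianReal, add_zero]
  rw [hconv, ← lintegral_indicator_one hA, Measure.lintegral_conv (by fun_prop (disch := exact hA))]
  refine lintegral_congr fun w => ?_
  have hshift : gaussianReal w V = (gaussianReal 0 V).map (w + ·) := by
    rw [gaussianReal_map_const_add, zero_add]
  rw [← lintegral_indicator_one hA, hshift, lintegral_map (by fun_prop (disch := exact hA))
    (by fun_prop)]

lemma measurable_gaussianReal_apply (V : ℝ≥0) (A : Set ℝ) (hA : MeasurableSet A) :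
    Measurable fun w => gaussianReal w V A :=
  (Measure.measurable_coe hA).comp (measurable_gaussianReal.comp (by fun_prop :
    Measurable fun w : ℝ => (w, V)))

lemma integrable_gaussianReal_real (V : ℝ≥0) {A : Set ℝ} (hA : MeasurableSet A) (μ : Measure ℝ)
    [IsFiniteMeasure μ] : Integrable (fun w => (gaussianReal w V).real A) μ :=
  .of_bound (measurable_gaussianReal_apply V A hA).ennreal_toReal.aestronglyMeasurable 1
    (ae_of_all _ fun w => by
      rw [Real.norm_of_nonneg measureReal_nonneg]
      exact measureReal_le_one)

lemma integral_gaussianReal_real (x : ℝ) (v V : ℝ≥0) {A : Set ℝ} (hA : MeasurableSet A) :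
    ∫ w, (gaussianReal w V).real A ∂gaussianReal x v = (gaussianReal x (v + V)).real A := by
  rw [measureReal_def, ← lintegral_gaussianReal_apply x v V hA]
  exact integral_toReal (measurable_gaussianReal_apply V A hA).aemeasurable
    (ae_of_all _ fun w => measure_lt_top _ _)

lemma integrable_brownianSurvival (V : ℝ≥0) (μ : Measure ℝ) [IsFiniteMeasure μ] :
    Integrable (brownianSurvival V) μ :=
  (integrable_gaussianReal_real V measurableSet_Iio μ).sub
    (integrable_gaussianReal_real V measurableSet_Ioi μ)

lemma integral_brownianSurvival (x : ℝ) (v V : ℝ≥0) :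
    ∫ w, brownianSurvival V w ∂gaussianReal x v = brownianSurvival (v + V) x := by
  simp only [brownianSurvival]
  rw [integral_sub (integrable_gaussianReal_real V measurableSet_Iio _)
    (integrable_gaussianReal_real V measurableSet_Ioi _),
    integral_gaussianReal_real _ _ _ measurableSet_Iio,
    integral_gaussianReal_real _ _ _ measurableSet_Ioi]

lemma ofReal_brownianSurvival_le_killedStep (V : ℝ≥0) (c x : ℝ) :
    ENNReal.ofReal (brownianSurvival (.mk (c ^ 2) (sq_nonneg c) + V) x) ≤
      killedStep c (fun w => ENNReal.ofReal (brownianSurvival V w)) x := by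
  set N := gaussianReal x (.mk (c ^ 2) (sq_nonneg c)) with hN
  have hint := integrable_brownianSurvival V N
  have hneg : ∀ w ∈ Set.Iio 0, 0 ≤ brownianSurvival V w := fun w (hw : w < 0) => by
    simpa using antitone_brownianSurvival V hw.le
  have hpos : ∫ w in (Set.Iio 0)ᶜ, brownianSurvival V w ∂N ≤ 0 :=
    setIntegral_nonpos measurableSet_Iio.compl fun w hw => by
      simpa using antitone_brownianSurvival V (not_lt.1 hw)
  rw [killedStep, ← integral_brownianSurvival, ← hN, ← ofReal_integral_eq_lintegral_ofReal
    hint.integrableOn ((ae_restrict_mem measurableSet_Iio).mono hneg),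
    ← integral_add_compl measurableSet_Iio hint]
  exact ENNReal.ofReal_le_ofReal (by linarith)

variable {c : ℕ → ℝ}

lemma setLIntegral_brownianSurvival_le_walkNeg (n : ℕ) :
    ∫⁻ x in walkNeg c 1, ENNReal.ofReal (brownianSurvival
        (∑ i ∈ Finset.range n, .mk (c (i + 1) ^ 2) (sq_nonneg _)) (walk c 1 x)) ∂stdSeq ≤
      stdSeq (walkNeg c (n + 1)) := by
  set V : ℕ → ℝ≥0 := fun k => ∑ i ∈ Finset.Ico k n, .mk (c (i + 1) ^ 2) (sq_nonneg _)
  set h : ℝ≥0 → ℝ → ℝ≥0∞ := fun V w => ENNReal.ofReal (brownianSurvival V w)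
  have hm : ∀ V, Measurable (h V) := fun V =>
    (antitone_brownianSurvival V).measurable.ennreal_ofReal
  have hmono : ∀ k ≤ n, ∫⁻ x in walkNeg c 1, h (V 0) (walk c 1 x) ∂stdSeq ≤
      ∫⁻ x in walkNeg c (k + 1), h (V k) (walk c (k + 1) x) ∂stdSeq := by
    intro k hk
    induction k with
    | zero => rfl
    | succ k ih =>
      have hV : V k = .mk (c (k + 1) ^ 2) (sq_nonneg _) + V (k + 1) :=
        Finset.sum_eq_sum_Ico_succ_bot (by omega) _
      grw [ih (by omega)]
      rw [setLIntegral_walkNeg_succ c (k + 1) (hm _), hV]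
      exact lintegral_mono fun _ => ofReal_brownianSurvival_le_killedStep _ _ _
  calc _ = ∫⁻ x in walkNeg c 1, h (V 0) (walk c 1 x) ∂stdSeq := by
        simp only [V, h, Nat.Ico_zero_eq_range]
    _ ≤ ∫⁻ x in walkNeg c (n + 1), h (V n) (walk c (n + 1) x) ∂stdSeq := hmono n le_rfl
    _ ≤ ∫⁻ _ in walkNeg c (n + 1), 1 ∂stdSeq :=
        lintegral_mono fun _ => by simpa [h] using brownianSurvival_le_one _ _
    _ = stdSeq (walkNeg c (n + 1)) := by simp

lemma mul_brownianSurvival_le_walkNeg (hc0 : 0 < c 0) (n : ℕ) :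
    (gaussianReal 0 1).real (Set.Iio (-1)) * brownianSurvival
        (∑ i ∈ Finset.range n, .mk (c (i + 1) ^ 2) (sq_nonneg _)) (-c 0) ≤
      stdSeq.real (walkNeg c (n + 1)) := by
  set V : ℝ≥0 := ∑ i ∈ Finset.range n, .mk (c (i + 1) ^ 2) (sq_nonneg _)
  have hm := (antitone_brownianSurvival V).measurable.ennreal_ofReal
  have hstart : (gaussianReal 0 (.mk (c 0 ^ 2) (sq_nonneg _))) (Set.Iio (-c 0)) =
      gaussianReal 0 1 (Set.Iio (-1)) := by
    rw [← gaussianReal_map_const_add_const_mul, Measure.map_apply (by fun_prop) measurableSet_Iio]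
    congr 1
    ext y
    simp only [Set.mem_preimage, Set.mem_Iio, zero_add]
    rw [← mul_neg_one (c 0), mul_lt_mul_iff_right₀ hc0]
  have hle : ENNReal.ofReal (brownianSurvival V (-c 0)) * gaussianReal 0 1 (Set.Iio (-1)) ≤
      stdSeq (walkNeg c (n + 1)) := by
    refine le_trans ?_ (setLIntegral_brownianSurvival_le_walkNeg n)
    rw [setLIntegral_walkNeg_one c hm, killedStep, ← hstart, ← setLIntegral_const]
    calc _ ≤ _ := setLIntegral_mono' measurableSet_Iio fun w (hw : w < -c 0) =>
          ENNReal.ofReal_le_ofReal (antitone_brownianSurvival V hw.le)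
      _ ≤ _ := lintegral_mono_set (Set.Iio_subset_Iio (by linarith))
  have hnonneg : 0 ≤ brownianSurvival V (-c 0) := by
    simpa using antitone_brownianSurvival V (neg_nonpos.2 hc0.le)
  have hle_real := ENNReal.toReal_mono (measure_ne_top _ _) hle
  rwa [ENNReal.toReal_mul, ENNReal.toReal_ofReal hnonneg, mul_comm] at hle_real

lemma exists_le_stdSeq_real_walkNeg : ∃ K > 0, ∀ (c : ℕ → ℝ) (n : ℕ), 0 < c 0 →
    2 * c 0 ^ 2 ≤ walkSd c (n + 1) ^ 2 →
    K * (c 0 / walkSd c (n + 1)) ≤ stdSeq.real (walkNeg c (n + 1)) := by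
  have hp : 0 < (gaussianReal 0 1).real (Set.Iio (-1)) :=
    gaussianReal_real_pos 0 one_ne_zero isOpen_Iio Set.nonempty_Iio
  refine ⟨(gaussianReal 0 1).real (Set.Iio (-1)) * (2 * Real.exp (-(1 / 2)) / √(2 * Real.pi)),
    by positivity, fun c n hc0 hsd => ?_⟩
  set V : ℝ≥0 := ∑ i ∈ Finset.range n, .mk (c (i + 1) ^ 2) (sq_nonneg _) with hV_def
  have hV : walkSd c (n + 1) ^ 2 = V + c 0 ^ 2 := by
    rw [walkSd_sq, Finset.sum_range_succ', hV_def, NNReal.coe_sum]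
    rfl
  have hcV : c 0 ^ 2 ≤ V := by linarith
  have hV0 : (0 : ℝ) < V := (pow_pos hc0 2).trans_le hcV
  have hsd_le : √V ≤ walkSd c (n + 1) :=
    Real.sqrt_le_iff.2 ⟨(walkSd_pos hc0 n).le, by nlinarith⟩
  have hdiv : c 0 / walkSd c (n + 1) ≤ c 0 / √V := by gcongr
  refine le_trans ?_ (mul_brownianSurvival_le_walkNeg hc0 n)
  grw [← le_brownianSurvival (by exact_mod_cast hV0.ne') hc0.le hcV, ← hdiv]
  rw [mul_assoc]

end WalkLower

/-! ### Comparison with the standard Gaussian measure -/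

section DensityComparison

lemma gaussianReal_le_smul {a v : ℝ} (ha : 0 < a) (hav : a ≤ v) (hv : v ≤ 1) :
    gaussianReal 0 v.toNNReal ≤ (√a)⁻¹.toNNReal • gaussianReal 0 1 := by
  have hv0 : 0 < v := ha.trans_le hav
  change _ ≤ ENNReal.ofReal (√a)⁻¹ • gaussianReal 0 1
  rw [gaussianReal_of_var_ne_zero _ (by simpa using hv0), gaussianReal_of_var_ne_zero _ one_ne_zero,
    ← withDensity_smul _ (measurable_gaussianPDF _ _)]
  refine withDensity_mono (ae_of_all _ fun x => ?_)
  simp only [Pi.smul_apply, smul_eq_mul, gaussianPDF]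
  rw [← ENNReal.ofReal_mul (by positivity)]
  refine ENNReal.ofReal_le_ofReal ?_
  simp only [gaussianPDFReal, Real.coe_toNNReal _ hv0.le, NNReal.coe_one, mul_one, sub_zero]
  rw [Real.sqrt_mul (by positivity), mul_inv, ← mul_assoc, mul_comm (√a)⁻¹]
  have hexp : Real.exp (-x ^ 2 / (2 * v)) ≤ Real.exp (-x ^ 2 / 2) := by
    rw [Real.exp_le_exp, neg_div, neg_div, neg_le_neg_iff]
    exact div_le_div_of_nonneg_left (sq_nonneg x) (by positivity) (by linarith)
  grw [hexp, hav]

variable {ι : Type*} [Fintype ι]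

lemma measure_pi_mono {α : ι → Type*} [∀ i, MeasurableSpace (α i)] {μ ν : ∀ i, Measure (α i)}
    [∀ i, SigmaFinite (μ i)] (h : ∀ i, μ i ≤ ν i) : Measure.pi μ ≤ Measure.pi ν := by
  have houter : (Measure.pi μ).toOuterMeasure ≤
      OuterMeasure.pi fun i => (ν i).toOuterMeasure := by
    refine OuterMeasure.le_pi.2 fun s _ => ?_
    change Measure.pi μ _ ≤ _
    rw [Measure.pi_pi]
    exact Finset.prod_le_prod' fun i _ => h i (s i)
  refine Measure.le_iff.2 fun A hA => ?_
  rw [Measure.pi_def ν, toMeasure_apply _ _ hA]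
  exact houter A

lemma measure_pi_smul {α : ι → Type*} [∀ i, MeasurableSpace (α i)] (c : ι → ℝ≥0)
    (μ : ∀ i, Measure (α i)) [∀ i, SigmaFinite (μ i)] :
    Measure.pi (fun i => c i • μ i) = (∏ i, c i) • Measure.pi μ := by
  refine Measure.pi_eq fun s _ => ?_
  simp only [Measure.smul_apply, ENNReal.smul_def, Measure.pi_pi, smul_eq_mul,
    Finset.prod_mul_distrib, ENNReal.ofNNReal_finsetProd]

variable [DecidableEq ι] {R : Matrix ι ι ℝ}

lemma dotProduct_mulVec_eq_sum_eigenvalues (hR : R.IsHermitian) (t : EuclideanSpace ℝ ι) :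
    t.ofLp ⬝ᵥ R *ᵥ t.ofLp = ∑ i, hR.eigenvalues i * ⟪hR.eigenvectorBasis i, t⟫ ^ 2 := by
  set b := hR.eigenvectorBasis
  have hRt : R *ᵥ t.ofLp = ∑ i, (⟪b i, t⟫ * hR.eigenvalues i) • (b i).ofLp := by
    conv_lhs => rw [← b.sum_repr' t]
    rw [WithLp.ofLp_sum, Matrix.mulVec_sum]
    refine Finset.sum_congr rfl fun i _ => ?_
    rw [WithLp.ofLp_smul, Matrix.mulVec_smul, hR.mulVec_eigenvectorBasis, smul_smul]
  rw [hRt, dotProduct_sum]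
  refine Finset.sum_congr rfl fun i _ => ?_
  have hinner : t.ofLp ⬝ᵥ (b i).ofLp = ⟪b i, t⟫ := by simp [PiLp.inner_apply, dotProduct]
  rw [dotProduct_smul, hinner, smul_eq_mul]
  ring

lemma multivariateGaussian_eq_map_pi (hR : R.PosSemidef) :
    multivariateGaussian 0 R =
      (Measure.pi fun i => gaussianReal 0 (hR.isHermitian.eigenvalues i).toNNReal).map
        (fun x => ∑ i, x i • hR.isHermitian.eigenvectorBasis i) := by
  set b := hR.isHermitian.eigenvectorBasis
  set l := hR.isHermitian.eigenvalues
  have hmeas : Measurable (fun x : ι → ℝ => ∑ i, x i • b i) := by fun_prop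
  have := Measure.isProbabilityMeasure_map hmeas.aemeasurable
    (μ := Measure.pi fun i => gaussianReal 0 (l i).toNNReal)
  apply Measure.ext_of_charFun
  ext t
  rw [charFun_multivariateGaussian hR, charFun_apply, integral_map hmeas.aemeasurable (by fun_prop),
    dotProduct_mulVec_eq_sum_eigenvalues hR.isHermitian]
  simp_rw [sum_inner, Complex.ofReal_sum, Finset.sum_mul, Complex.exp_sum,
    integral_fintype_prod_eq_prod (f := fun i (x : ℝ) ↦ Complex.exp (⟪x • b i, t⟫ * Complex.I)),
    real_inner_smul_left, mul_comm _ (⟪_, _⟫), Complex.ofReal_mul, ← charFun_apply_real,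
    charFun_gaussianReal, ← Complex.exp_sum]
  congr 1
  simp only [inner_zero_right, Complex.ofReal_zero, mul_zero, zero_mul, zero_sub]
  push_cast
  rw [Finset.sum_div, ← Finset.sum_neg_distrib]
  refine Finset.sum_congr rfl fun i _ => ?_
  rw [Real.coe_toNNReal _ (hR.eigenvalues_nonneg i)]

lemma multivariateGaussian_le_smul_stdGaussian (hR : R.PosSemidef) {a : ℝ} (ha : 0 < a)
    (hlow : ∀ x, a * (x ⬝ᵥ x) ≤ x ⬝ᵥ R *ᵥ x) (hupp : ∀ x, x ⬝ᵥ R *ᵥ x ≤ x ⬝ᵥ x) :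
    multivariateGaussian 0 R ≤
      (√a)⁻¹.toNNReal ^ Fintype.card ι • stdGaussian (EuclideanSpace ℝ ι) := by
  set b := hR.isHermitian.eigenvectorBasis
  set l := hR.isHermitian.eigenvalues
  have hunit : ∀ i, (b i).ofLp ⬝ᵥ (b i).ofLp = 1 := fun i => by
    have := real_inner_self_eq_norm_sq (b i)
    rw [b.orthonormal.1 i, one_pow] at this
    rw [← this, EuclideanSpace.inner_eq_star_dotProduct, star_trivial]
  have hl : ∀ i, (b i).ofLp ⬝ᵥ R *ᵥ (b i).ofLp = l i := fun i =>
    (hR.isHermitian.eigenvalues_eq i).symm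
  have hal : ∀ i, a ≤ l i := fun i => by simpa only [hunit, hl, mul_one] using hlow (b i).ofLp
  have hl1 : ∀ i, l i ≤ 1 := fun i => by simpa only [hunit, hl] using hupp (b i).ofLp
  rw [multivariateGaussian_eq_map_pi hR, stdGaussian_eq_map_pi_orthonormalBasis b,
    ← Measure.map_smul]
  refine Measure.map_mono ?_ (by fun_prop)
  calc _ ≤ Measure.pi fun _ : ι => (√a)⁻¹.toNNReal • gaussianReal 0 1 :=
        measure_pi_mono fun i => gaussianReal_le_smul ha (hal i) (hl1 i)
    _ = _ := by rw [measure_pi_smul, Finset.prod_const, Finset.card_univ]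

omit [DecidableEq ι] in
lemma mul_dotProduct_le_dotProduct_mulVec {e : ℝ} (hnonneg : ∀ i j, 0 ≤ R i j)
    (hdiag : ∀ i, 1 - e ≤ R i i) (hupp : ∀ x, x ⬝ᵥ R *ᵥ x ≤ x ⬝ᵥ x) (x : ι → ℝ) :
    (1 - 2 * e) * (x ⬝ᵥ x) ≤ x ⬝ᵥ R *ᵥ x := by
  have hquad : ∀ y : ι → ℝ, y ⬝ᵥ R *ᵥ y = ∑ i, ∑ j, R i j * (y i * y j) := fun y => by
    simp only [dotProduct, Matrix.mulVec, Finset.mul_sum]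
    exact Finset.sum_congr rfl fun i _ => Finset.sum_congr rfl fun j _ => by ring
  have hdiag_le : 2 * ((1 - e) * (x ⬝ᵥ x)) ≤ x ⬝ᵥ R *ᵥ x + |x| ⬝ᵥ R *ᵥ |x| := by
    rw [hquad, hquad, dotProduct]
    simp only [Finset.mul_sum, ← Finset.sum_add_distrib, ← mul_add, Pi.abs_apply]
    refine Finset.sum_le_sum fun i _ => ?_
    calc 2 * ((1 - e) * (x i * x i)) ≤ R i i * (x i * x i + |x i| * |x i|) := by
          rw [abs_mul_abs_self]
          nlinarith [mul_le_mul_of_nonneg_right (hdiag i) (mul_self_nonneg (x i))]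
      _ ≤ _ := Finset.single_le_sum (f := fun j => R i j * (x i * x j + |x i| * |x j|))
          (fun j _ => mul_nonneg (hnonneg i j) (by
            rw [← abs_mul]; linarith [neg_abs_le (x i * x j)])) (Finset.mem_univ i)
  have habs : |x| ⬝ᵥ |x| = x ⬝ᵥ x := by simp [dotProduct]
  linarith [hupp |x|]

variable {Ω : Type*} [MeasurableSpace Ω] {P : Measure Ω} {X : ι → Ω → ℝ}

omit [DecidableEq ι] in
lemma map_toLp_le_smul_stdGaussian (hX : HasGaussianLaw (fun ω i => X i ω) P)
    (hmean : ∀ i, P[X i] = 0) {e : ℝ} (he : e < 1 / 2) (hcov : ∀ i j, 0 ≤ cov[X i, X j; P])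
    (hvar : ∀ i, 1 - e ≤ Var[X i; P])
    (hupp : ∀ x : ι → ℝ, Var[fun ω => ∑ i, x i * X i ω; P] ≤ ∑ i, x i ^ 2) :
    P.map (fun ω => WithLp.toLp 2 fun i => X i ω) ≤
      (√(1 - 2 * e))⁻¹.toNNReal ^ Fintype.card ι • stdGaussian (EuclideanSpace ℝ ι) := by
  classical
  have := hX.isProbabilityMeasure
  have hXL : ∀ i, MemLp (X i) 2 P := fun i => (hX.eval i).memLp_two
  have hupp' : ∀ x, x ⬝ᵥ covarianceMatrix X P *ᵥ x ≤ x ⬝ᵥ x := fun x => by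
    rw [dotProduct_covarianceMatrix_mulVec hXL]
    simpa only [dotProduct, ← sq] using hupp x
  have hmean0 : (WithLp.toLp 2 fun i => P[X i] : EuclideanSpace ℝ ι) = 0 := by
    simp only [hmean]
    rfl
  rw [map_toLp_eq_multivariateGaussian hX, hmean0]
  refine multivariateGaussian_le_smul_stdGaussian (posSemidef_covarianceMatrix hXL)
    (by linarith) (fun x => ?_) hupp'
  refine mul_dotProduct_le_dotProduct_mulVec hcov (fun i => ?_) hupp' x
  exact (hvar i).trans_eq (covariance_self (hXL i).aemeasurable).symm

end DensityComparison

/-! ### Linear combinations of Gaussian processes -/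

section LinearCombinations

variable {Ω T S : Type*} [MeasurableSpace Ω] {P : Measure Ω} {ξ : T → Ω → ℝ}

lemma isGaussianProcess_sum_mul (hξ : IsGaussianProcess ξ P) (s : S → Finset T) (a : S → T → ℝ) :
    IsGaussianProcess (fun t ω => ∑ i ∈ s t, a t i * ξ i ω) P := by
  refine hξ.of_isGaussianProcess fun t =>
    ⟨s t, ∑ i : s t, a t i • ContinuousLinearMap.proj i, fun ω => ?_⟩
  rw [← Finset.sum_coe_sort]
  simp [Finset.restrict]

lemma hasGaussianLaw_comp (hξ : IsGaussianProcess ξ P) {ι : Type*} [Finite ι] (t : ι → T) :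
    HasGaussianLaw (fun ω i => ξ (t i) ω) P := by
  have := Fintype.ofFinite ι
  exact ((hξ.comp_right t).hasGaussianLaw Finset.univ).map_fun
    (ContinuousLinearMap.pi fun i => ContinuousLinearMap.proj
      (⟨i, Finset.mem_univ i⟩ : (Finset.univ : Finset ι)))

lemma integral_sum_mul (hξ : IsGaussianProcess ξ P) (hmean : ∀ i, P[ξ i] = 0) (s : Finset T)
    (a : T → ℝ) : ∫ ω, ∑ i ∈ s, a i * ξ i ω ∂P = 0 := by
  rw [integral_finsetSum _ fun i _ => (hξ.hasGaussianLaw_eval i).integrable.const_mul _]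
  simp [integral_const_mul, hmean]

lemma covariance_sum_mul_sum_mul (hξ : IsGaussianProcess ξ P) (s t : Finset T) (a b : T → ℝ) :
    cov[fun ω => ∑ i ∈ s, a i * ξ i ω, fun ω => ∑ j ∈ t, b j * ξ j ω; P] =
      ∑ i ∈ s, ∑ j ∈ t, a i * b j * cov[ξ i, ξ j; P] := by
  have := hξ.isProbabilityMeasure
  have hmem : ∀ (c : T → ℝ) i, MemLp (fun ω => c i * ξ i ω) 2 P := fun c i =>
    (hξ.hasGaussianLaw_eval i).memLp_two.const_mul (c i)
  rw [covariance_fun_sum_fun_sum' (fun i _ => hmem a i) fun j _ => hmem b j]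
  simp only [covariance_const_mul_left, covariance_const_mul_right]
  exact Finset.sum_congr rfl fun i _ => Finset.sum_congr rfl fun j _ => by ring

end LinearCombinations

section StdSeq

lemma iIndepFun_stdSeq : iIndepFun (fun i (x : ℕ → ℝ) => x i) stdSeq :=
  iIndepFun_infinitePi (X := fun _ x => x) fun _ => measurable_id

lemma hasLaw_stdSeq (i : ℕ) : HasLaw (fun x : ℕ → ℝ => x i) (gaussianReal 0 1) stdSeq :=
  ⟨(measurable_pi_apply i).aemeasurable, Measure.infinitePi_map_eval _ i⟩

lemma hasGaussianLaw_stdSeq (i : ℕ) : HasGaussianLaw (fun x : ℕ → ℝ => x i) stdSeq :=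
  (hasLaw_stdSeq i).hasGaussianLaw

lemma isGaussianProcess_stdSeq : IsGaussianProcess (fun i (x : ℕ → ℝ) => x i) stdSeq where
  hasGaussianLaw I := (iIndepFun_stdSeq.precomp (g := fun i : I => (i : ℕ))
    Subtype.val_injective).hasGaussianLaw fun i => hasGaussianLaw_stdSeq i

lemma integral_stdSeq (i : ℕ) : ∫ x, x i ∂stdSeq = 0 := by
  simpa using (hasLaw_stdSeq i).integral_eq

lemma covariance_stdSeq (i j : ℕ) :
    cov[fun x : ℕ → ℝ => x i, fun x => x j; stdSeq] = if i = j then 1 else 0 := by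
  split_ifs with hij
  · subst hij
    rw [covariance_self (hasLaw_stdSeq i).aemeasurable, (hasLaw_stdSeq i).variance_eq,
      variance_id_gaussianReal, NNReal.coe_one]
  · exact (iIndepFun_stdSeq.indepFun hij).covariance_eq_zero
      (hasGaussianLaw_stdSeq i).memLp_two (hasGaussianLaw_stdSeq j).memLp_two

lemma map_stdSeq_eq_stdGaussian (n : ℕ) :
    stdSeq.map (fun x => WithLp.toLp 2 fun l : Fin n => x l) =
      stdGaussian (EuclideanSpace ℝ (Fin n)) := by
  have hpi : stdSeq.map (fun x (l : Fin n) => x l) = Measure.pi fun _ => gaussianReal 0 1 := by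
    rw [(iIndepFun_iff_map_fun_eq_pi_map fun i => (hasLaw_stdSeq _).aemeasurable).1
      (iIndepFun_stdSeq.precomp Fin.val_injective)]
    simp only [(hasLaw_stdSeq _).map_eq]
  rw [← map_pi_eq_stdGaussian, ← hpi, Measure.map_map (by fun_prop) (by fun_prop)]
  rfl

lemma covariance_walk (c : ℕ → ℝ) (k l : ℕ) :
    cov[walk c k, walk c l; stdSeq] = ∑ i ∈ Finset.range (min k l), c i ^ 2 := by
  change cov[fun x : ℕ → ℝ => ∑ i ∈ Finset.range k, c i * x i,
    fun x : ℕ → ℝ => ∑ i ∈ Finset.range l, c i * x i; stdSeq] = _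
  rw [covariance_sum_mul_sum_mul isGaussianProcess_stdSeq]
  simp only [covariance_stdSeq, mul_ite, mul_one, mul_zero, Finset.sum_ite_eq, Finset.mem_range]
  rw [← Finset.sum_filter]
  refine Finset.sum_congr ?_ fun i _ => (sq (c i)).symm
  ext i
  simp

lemma variance_walk (c : ℕ → ℝ) (k : ℕ) : Var[walk c k; stdSeq] = walkSd c k ^ 2 := by
  rw [← covariance_self (by fun_prop), covariance_walk, min_self, walkSd_sq]

lemma isGaussianProcess_walk (c : ℕ → ℝ) : IsGaussianProcess (walk c) stdSeq :=
  isGaussianProcess_sum_mul isGaussianProcess_stdSeq Finset.range fun _ => c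

lemma integral_walk (c : ℕ → ℝ) (k : ℕ) : stdSeq[walk c k] = 0 :=
  integral_sum_mul isGaussianProcess_stdSeq integral_stdSeq _ c

variable {Ω : Type*} [MeasurableSpace Ω] {P : Measure Ω} {X : ℕ → Ω → ℝ}

lemma mem_walkNeg_congr (c : ℕ → ℝ) {n : ℕ} {x y : ℕ → ℝ} (hxy : ∀ i < n, x i = y i) :
    x ∈ walkNeg c n ↔ y ∈ walkNeg c n := by
  refine forall₂_congr fun l hl => ?_
  rw [walk, walk, Finset.sum_congr rfl fun i hi => ?_]
  rw [hxy i (by have := Finset.mem_range.1 hi; omega)]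

lemma measure_walkNeg_le_mul_stdSeq (hX : IsGaussianProcess X P) (hmean : ∀ i, P[X i] = 0)
    {e : ℝ} (he : e < 1 / 2) (hcov : ∀ i j, 0 ≤ cov[X i, X j; P])
    (hvar : ∀ i, 1 - e ≤ Var[X i; P])
    (hupp : ∀ (n : ℕ) (x : ℕ → ℝ),
      Var[fun ω => ∑ i ∈ Finset.range n, x i * X i ω; P] ≤ ∑ i ∈ Finset.range n, x i ^ 2)
    (c : ℕ → ℝ) (n : ℕ) :
    P {ω | (fun i => X i ω) ∈ walkNeg c n} ≤
      ENNReal.ofReal (√(1 - 2 * e))⁻¹ ^ n * stdSeq (walkNeg c n) := by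
  set E : EuclideanSpace ℝ (Fin n) → ℕ → ℝ := fun y i => if h : i < n then y ⟨i, h⟩ else 0
  have hE : Measurable E := measurable_pi_iff.2 fun i => by
    by_cases h : i < n <;> simp only [E, h, dite_true, dite_false] <;> fun_prop
  have hEmem : ∀ x : ℕ → ℝ,
      E (WithLp.toLp 2 fun l : Fin n => x l) ∈ walkNeg c n ↔ x ∈ walkNeg c n := fun x =>
    mem_walkNeg_congr c fun i hi => by simp [E, hi]
  have hXmem : ∀ ω, E (WithLp.toLp 2 fun l : Fin n => X l ω) ∈ walkNeg c n ↔
      (fun i => X i ω) ∈ walkNeg c n := fun ω => hEmem fun i => X i ω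
  have hA : MeasurableSet (E ⁻¹' walkNeg c n) := hE (measurableSet_walkNeg c n)
  have hG : HasGaussianLaw (fun ω (i : Fin n) => X i ω) P := hasGaussianLaw_comp hX _
  have hle := map_toLp_le_smul_stdGaussian hG (fun i => hmean i) he (fun i j => hcov i j)
    (fun i => hvar i) (fun x => ?_) (E ⁻¹' walkNeg c n)
  · rw [← map_stdSeq_eq_stdGaussian,
      Measure.map_apply_of_aemeasurable (hG.toLp_pi 2).aemeasurable hA,
      Measure.smul_apply, Measure.map_apply (by fun_prop) hA, Fintype.card_fin] at hle
    simp only [Set.preimage, Set.mem_ofPred_eq, hEmem, hXmem, ENNReal.smul_def,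
      ENNReal.coe_pow, smul_eq_mul] at hle
    exact hle
  · have := hupp n fun i => if h : i < n then x ⟨i, h⟩ else 0
    simpa [Finset.sum_range] using this

end StdSeq

/-! ### Variances of weighted sums -/

section BlockCovariance

/-- The covariance of the weighted sums of a stationary sequence over the index sets `s` and `t`,
in terms of the correlation function `ρ` and the weights `σ`. -/
def blockCov (ρ σ : ℕ → ℝ) (s t : Finset ℕ) : ℝ :=
  ∑ i ∈ s, ∑ j ∈ t, σ i * σ j * ρ (Nat.dist i j)

/-- The sum `∑_{k ∈ ℤ} ρ(|k|)`, the limiting variance of a block sum per unit of squared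
weight. -/
noncomputable def totalCorr (ρ : ℕ → ℝ) : ℝ := ρ 0 + 2 * ∑' k, ρ (k + 1)

variable {ρ σ : ℕ → ℝ}

lemma blockCov_nonneg (hρ : ∀ i, 0 ≤ ρ i) {s t : Finset ℕ} (hs : ∀ i ∈ s, 0 ≤ σ i)
    (ht : ∀ j ∈ t, 0 ≤ σ j) : 0 ≤ blockCov ρ σ s t :=
  Finset.sum_nonneg fun i hi => Finset.sum_nonneg fun j hj =>
    mul_nonneg (mul_nonneg (hs i hi) (ht j hj)) (hρ _)

lemma blockCov_mono (hρ : ∀ i, 0 ≤ ρ i) {s t s' t' : Finset ℕ} (hs : s ⊆ s') (ht : t ⊆ t')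
    (hs' : ∀ i ∈ s', 0 ≤ σ i) (ht' : ∀ j ∈ t', 0 ≤ σ j) :
    blockCov ρ σ s t ≤ blockCov ρ σ s' t' := by
  have hterm : ∀ i ∈ s', ∀ j ∈ t', 0 ≤ σ i * σ j * ρ (Nat.dist i j) := fun i hi j hj =>
    mul_nonneg (mul_nonneg (hs' i hi) (ht' j hj)) (hρ _)
  calc blockCov ρ σ s t ≤ blockCov ρ σ s t' :=
        Finset.sum_le_sum fun i hi => Finset.sum_le_sum_of_subset_of_nonneg ht
          fun j hj _ => hterm i (hs hi) j hj
    _ ≤ blockCov ρ σ s' t' := Finset.sum_le_sum_of_subset_of_nonneg hs fun i hi _ =>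
        Finset.sum_nonneg fun j hj => hterm i hi j hj

lemma blockCov_self_eq (ρ σ : ℕ → ℝ) (s : Finset ℕ) :
    blockCov ρ σ s s = ρ 0 * ∑ i ∈ s, σ i ^ 2 +
      2 * ∑ i ∈ s, ∑ j ∈ s with i < j, σ i * σ j * ρ (j - i) := by
  set f : ℕ → ℕ → ℝ := fun i j => if i < j then σ i * σ j * ρ (j - i) else 0
  have hsplit : ∀ i j, σ i * σ j * ρ (Nat.dist i j) =
      (if i = j then ρ 0 * (σ i * σ j) else 0) + (f i j + f j i) := fun i j => by
    rcases lt_trichotomy i j with h | rfl | h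
    · simp [f, h, h.ne, h.le, h.not_gt, Nat.dist_eq_sub_of_le]
    · simp [f, mul_comm]
    · simp [f, h, h.ne', h.le, h.not_gt, Nat.dist_eq_sub_of_le_right, mul_comm]
  simp only [blockCov, hsplit, Finset.sum_add_distrib, Finset.sum_comm (f := fun i j => f j i)]
  have hdiag : ∀ i ∈ s, ∑ j ∈ s, (if i = j then ρ 0 * (σ i * σ j) else 0) = ρ 0 * σ i ^ 2 :=
    fun i hi => by rw [Finset.sum_ite_eq, if_pos hi, sq]
  rw [Finset.sum_congr rfl hdiag, ← Finset.mul_sum]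
  simp only [f, ← Finset.sum_filter]
  ring

lemma mul_sum_sq_le_blockCov_self (hρ : ∀ i, 0 ≤ ρ i) {s : Finset ℕ} (hσ : ∀ i ∈ s, 0 ≤ σ i) :
    ρ 0 * ∑ i ∈ s, σ i ^ 2 ≤ blockCov ρ σ s s := by
  rw [blockCov_self_eq, le_add_iff_nonneg_right]
  exact mul_nonneg zero_le_two <| Finset.sum_nonneg fun i hi => Finset.sum_nonneg fun j hj =>
    mul_nonneg (mul_nonneg (hσ i hi) (hσ j (Finset.mem_filter.1 hj).1)) (hρ _)

lemma le_totalCorr (hρ : ∀ i, 0 ≤ ρ i) : ρ 0 ≤ totalCorr ρ := by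
  rw [totalCorr, le_add_iff_nonneg_right]
  exact mul_nonneg zero_le_two (tsum_nonneg fun k => hρ _)

lemma sum_le_tsum_succ (hρ : ∀ i, 0 ≤ ρ i) (hsum : Summable ρ) {s : Finset ℕ} {g : ℕ → ℕ}
    (hg : Set.InjOn g s) (hpos : ∀ j ∈ s, 0 < g j) : ∑ j ∈ s, ρ (g j) ≤ ∑' k, ρ (k + 1) := by
  have hpred : ∀ j ∈ s, g j = g j - 1 + 1 := fun j hj => by have := hpos j hj; omega
  rw [Finset.sum_congr rfl fun j hj => congrArg ρ (hpred j hj),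
    ← Finset.sum_image (g := fun j => g j - 1) (f := fun k => ρ (k + 1))]
  · exact ((summable_nat_add_iff 1).2 hsum).sum_le_tsum _ fun k _ => hρ _
  · intro i hi j hj hij
    exact hg hi hj <|
      (hpred i hi).trans ((congrArg (· + 1) hij).trans (hpred j hj).symm)

lemma blockCov_self_le (hρ : ∀ i, 0 ≤ ρ i) (hsum : Summable ρ) (s : Finset ℕ) :
    blockCov ρ σ s s ≤ totalCorr ρ * ∑ i ∈ s, σ i ^ 2 := by
  set R := ∑' k, ρ (k + 1)
  have hforward : ∑ i ∈ s, ∑ j ∈ s with i < j, σ i ^ 2 * ρ (j - i) ≤ R * ∑ i ∈ s, σ i ^ 2 := by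
    rw [Finset.mul_sum]
    refine Finset.sum_le_sum fun i _ => ?_
    rw [← Finset.mul_sum, mul_comm]
    refine mul_le_mul_of_nonneg_right (sum_le_tsum_succ hρ hsum (fun j hj k hk hjk => ?_)
      fun j hj => ?_) (sq_nonneg _)
    all_goals simp only [Finset.coe_filter, Set.mem_ofPred_eq, Finset.mem_filter] at *; omega
  have hbackward : ∑ i ∈ s, ∑ j ∈ s with i < j, σ j ^ 2 * ρ (j - i) ≤ R * ∑ i ∈ s, σ i ^ 2 := by
    simp only [Finset.sum_filter]
    rw [Finset.sum_comm, Finset.mul_sum]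
    refine Finset.sum_le_sum fun j _ => ?_
    rw [← Finset.sum_filter, ← Finset.mul_sum, mul_comm]
    refine mul_le_mul_of_nonneg_right (sum_le_tsum_succ hρ hsum (fun i hi k hk hik => ?_)
      fun i hi => ?_) (sq_nonneg _)
    all_goals simp only [Finset.coe_filter, Set.mem_ofPred_eq, Finset.mem_filter] at *; omega
  have hcross : 2 * ∑ i ∈ s, ∑ j ∈ s with i < j, σ i * σ j * ρ (j - i) ≤
      ∑ i ∈ s, ∑ j ∈ s with i < j, σ i ^ 2 * ρ (j - i) +
        ∑ i ∈ s, ∑ j ∈ s with i < j, σ j ^ 2 * ρ (j - i) := by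
    simp only [Finset.mul_sum, ← Finset.sum_add_distrib]
    refine Finset.sum_le_sum fun i _ => Finset.sum_le_sum fun j _ => ?_
    nlinarith [mul_nonneg (hρ (j - i)) (sq_nonneg (σ i - σ j))]
  rw [blockCov_self_eq, totalCorr]
  linarith

end BlockCovariance

section Scale

variable {σ : ℕ → ℝ}

lemma scale_sq (σ : ℕ → ℝ) (n : ℕ) : scale σ n ^ 2 = ∑ i ∈ Finset.Icc 1 n, σ i ^ 2 :=
  Real.sq_sqrt (Finset.sum_nonneg fun _ _ => sq_nonneg _)

lemma scale_nonneg (σ : ℕ → ℝ) (n : ℕ) : 0 ≤ scale σ n := Real.sqrt_nonneg _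

lemma scale_sq_sub (σ : ℕ → ℝ) {l m : ℕ} (h : l ≤ m) :
    scale σ m ^ 2 - scale σ l ^ 2 = ∑ i ∈ Finset.Ioc l m, σ i ^ 2 := by
  have hIoc : ∀ n, Finset.Icc 1 n = Finset.Ioc 0 n := fun n => Finset.Icc_succ_left_eq_Ioc 0 n
  rw [scale_sq, scale_sq, hIoc, hIoc, ← Finset.sum_Ioc_consecutive _ (Nat.zero_le l) h,
    add_sub_cancel_left]

lemma scale_mono (σ : ℕ → ℝ) : Monotone (scale σ) := fun _ _ h =>
  Real.sqrt_le_sqrt <| Finset.sum_le_sum_of_subset_of_nonneg (Finset.Icc_subset_Icc_right h)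
    fun _ _ _ => sq_nonneg _

lemma eventually_abs_weight_sub_le (hσ : ∀ i, 1 ≤ i → 0 < σ i)
    (hratio : ∀ l : ℕ, 1 ≤ l → Tendsto (fun n => σ (n + l) / σ n) atTop (𝓝 1))
    {ε : ℝ} (hε : 0 < ε) (A : ℕ) :
    ∀ᶠ n in atTop, ∀ i ≥ n, ∀ k ≤ A, |σ (i + k) - σ i| ≤ ε * σ i := by
  have hfix : ∀ᶠ i in atTop, ∀ k ∈ Finset.range (A + 1), |σ (i + k) - σ i| ≤ ε * σ i := by
    rw [eventually_all_finset]
    rintro (_ | k) _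
    · filter_upwards [eventually_ge_atTop 1] with i hi
      simpa using (mul_pos hε (hσ i hi)).le
    · filter_upwards [Metric.tendsto_nhds.1 (hratio (k + 1) (by omega)) ε hε,
        eventually_ge_atTop 1] with i hdist hi
      rw [Real.dist_eq, div_sub_one (hσ i hi).ne', abs_div, abs_of_pos (hσ i hi),
        div_lt_iff₀ (hσ i hi)] at hdist
      exact hdist.le
  filter_upwards [eventually_forall_ge_atTop.2 hfix] with n hn i hi k hk
  exact hn i hi k (Finset.mem_range_succ_iff.2 hk)

lemma eventually_weight_sq_le (hσ : ∀ i, 1 ≤ i → 0 < σ i)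
    (hratio : ∀ l : ℕ, 1 ≤ l → Tendsto (fun n => σ (n + l) / σ n) atTop (𝓝 1))
    {ε : ℝ} (hε : 0 < ε) : ∀ᶠ i in atTop, σ i ^ 2 ≤ ε * scale σ i ^ 2 := by
  obtain ⟨L, hL⟩ := exists_nat_gt (4 / ε)
  obtain ⟨N, hN⟩ := (eventually_abs_weight_sub_le hσ hratio one_pos L).exists
  filter_upwards [eventually_ge_atTop (N + L + 1)] with i hi
  have hterm : ∀ j ∈ Finset.Ioc (i - L) i, σ i ^ 2 / 4 ≤ σ j ^ 2 := fun j hj => by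
    rw [Finset.mem_Ioc] at hj
    have hij := (abs_le.1 (hN j (by omega) (i - j) (by omega))).2
    rw [Nat.add_sub_cancel' hj.2] at hij
    nlinarith [hσ i (by omega)]
  have hblock : L * (σ i ^ 2 / 4) ≤ scale σ i ^ 2 := by
    have hcard := Finset.card_nsmul_le_sum _ _ _ hterm
    rw [← scale_sq_sub σ (Nat.sub_le i L), Nat.card_Ioc, Nat.sub_sub_self (by omega),
      nsmul_eq_mul] at hcard
    linarith [sq_nonneg (scale σ (i - L))]
  rw [div_lt_iff₀ hε] at hL
  nlinarith [mul_le_mul_of_nonneg_left hblock hε.le, sq_nonneg (σ i)]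

lemma eventually_mul_scale_sq_le_scale_sub_sq (hσ : ∀ i, 1 ≤ i → 0 < σ i)
    (hratio : ∀ l : ℕ, 1 ≤ l → Tendsto (fun n => σ (n + l) / σ n) atTop (𝓝 1))
    {ε : ℝ} (hε : 0 < ε) (A : ℕ) :
    ∀ᶠ m in atTop, (1 - ε) * scale σ m ^ 2 ≤ scale σ (m - A) ^ 2 := by
  obtain ⟨N, hN⟩ := eventually_atTop.1
    (eventually_weight_sq_le hσ hratio (by positivity : 0 < ε / (A + 1)))
  filter_upwards [eventually_ge_atTop (N + A)] with m hm
  have hterm : ∀ i ∈ Finset.Ioc (m - A) m, σ i ^ 2 ≤ ε / (A + 1) * scale σ m ^ 2 := fun i hi => by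
    rw [Finset.mem_Ioc] at hi
    have hmono := pow_le_pow_left₀ (scale_nonneg σ i) (scale_mono σ hi.2) 2
    exact (hN i (by omega)).trans (by gcongr)
  have htail : scale σ m ^ 2 - scale σ (m - A) ^ 2 ≤ ε * scale σ m ^ 2 := by
    rw [scale_sq_sub σ (Nat.sub_le m A)]
    calc _ ≤ A * (ε / (A + 1) * scale σ m ^ 2) := by
          simpa [Nat.sub_sub_self (by omega : A ≤ m)] using Finset.sum_le_card_nsmul _ _ _ hterm
      _ ≤ (A + 1) * (ε / (A + 1) * scale σ m ^ 2) := by gcongr; linarith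
      _ = ε * scale σ m ^ 2 := by field_simp
  linarith

end Scale

section BlockVariance

variable {ρ σ : ℕ → ℝ}

lemma mul_scale_sq_sub_le_blockCov (hρ : ∀ i, 0 ≤ ρ i) (hσ : ∀ i, 1 ≤ i → 0 < σ i)
    {A l m : ℕ} {ε : ℝ} (hε : 0 ≤ ε)
    (hl : ∀ i ≥ l, ∀ k ≤ A, |σ (i + k) - σ i| ≤ ε * σ i) (hlm : l + A ≤ m) :
    (1 - ε) * (ρ 0 + 2 * ∑ k ∈ Finset.range A, ρ (k + 1)) *
      (scale σ (m - A) ^ 2 - scale σ l ^ 2) ≤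
        blockCov ρ σ (Finset.Ioc l m) (Finset.Ioc l m) := by
  have hσl : ∀ {i}, l < i → 0 < σ i := fun h => hσ _ (by omega)
  have hrow : ∀ i ∈ Finset.Ioc l (m - A), (1 - ε) * (∑ k ∈ Finset.range A, ρ (k + 1)) * σ i ^ 2 ≤
      ∑ j ∈ Finset.Ioc l m with i < j, σ i * σ j * ρ (j - i) := fun i hi => by
    rw [Finset.mem_Ioc] at hi
    calc (1 - ε) * (∑ k ∈ Finset.range A, ρ (k + 1)) * σ i ^ 2
        ≤ ∑ k ∈ Finset.range A, σ i * σ (i + (k + 1)) * ρ (i + (k + 1) - i) := by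
          rw [Finset.mul_sum, Finset.sum_mul]
          refine Finset.sum_le_sum fun k hk => ?_
          have hik := (abs_le.1 (hl i hi.1.le (k + 1) (Finset.mem_range.1 hk))).1
          rw [Nat.add_sub_cancel_left]
          nlinarith [mul_nonneg (hσl hi.1).le (hρ (k + 1))]
      _ = ∑ j ∈ (Finset.range A).image fun k => i + (k + 1), σ i * σ j * ρ (j - i) := by
          rw [Finset.sum_image fun a _ b _ hab => by simpa using hab]
      _ ≤ _ := by
          refine Finset.sum_le_sum_of_subset_of_nonneg (fun j hj => ?_) fun j hj _ =>
            mul_nonneg (mul_nonneg (hσl hi.1).le (hσl (hi.1.trans (Finset.mem_filter.1 hj).2)).le)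
              (hρ _)
          simp only [Finset.mem_image, Finset.mem_range, Finset.mem_filter, Finset.mem_Ioc] at hj ⊢
          omega
  have hsub : Finset.Ioc l (m - A) ⊆ Finset.Ioc l m := Finset.Ioc_subset_Ioc_right (Nat.sub_le _ _)
  have hdiag : (1 - ε) * ρ 0 * ∑ i ∈ Finset.Ioc l (m - A), σ i ^ 2 ≤
      ρ 0 * ∑ i ∈ Finset.Ioc l m, σ i ^ 2 := by
    have := Finset.sum_le_sum_of_subset_of_nonneg hsub fun i _ _ => sq_nonneg (σ i)
    have hnonneg : 0 ≤ ∑ i ∈ Finset.Ioc l (m - A), σ i ^ 2 :=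
      Finset.sum_nonneg fun _ _ => sq_nonneg _
    nlinarith [mul_le_mul_of_nonneg_left this (hρ 0), mul_nonneg hε (mul_nonneg (hρ 0) hnonneg)]
  have hoff := (Finset.sum_le_sum hrow).trans <|
    Finset.sum_le_sum_of_subset_of_nonneg hsub fun i hi _ => Finset.sum_nonneg fun j hj =>
      mul_nonneg (mul_nonneg (hσl (Finset.mem_Ioc.1 hi).1).le
        (hσl (Finset.mem_Ioc.1 (Finset.mem_filter.1 hj).1).1).le) (hρ _)
  rw [blockCov_self_eq, scale_sq_sub σ (by omega)]
  rw [← Finset.mul_sum] at hoff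
  linarith

lemma eventually_le_blockCov (hρ : ∀ i, 0 ≤ ρ i) (hρ0 : 0 < ρ 0) (hsum : Summable ρ)
    (hσ : ∀ i, 1 ≤ i → 0 < σ i)
    (hratio : ∀ l : ℕ, 1 ≤ l → Tendsto (fun n => σ (n + l) / σ n) atTop (𝓝 1))
    {e θ : ℝ} (he : 0 < e) (he1 : e ≤ 1) (hθ : 0 < θ) :
    ∀ᶠ l in atTop, ∀ m ≥ l, θ * scale σ m ^ 2 ≤ scale σ m ^ 2 - scale σ l ^ 2 →
      (1 - e) * (totalCorr ρ * (scale σ m ^ 2 - scale σ l ^ 2)) ≤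
        blockCov ρ σ (Finset.Ioc l m) (Finset.Ioc l m) := by
  have hκ : 0 < totalCorr ρ := hρ0.trans_le (le_totalCorr hρ)
  set κ := totalCorr ρ
  obtain ⟨A, hA⟩ : ∃ A, (1 - e / 3) * κ < ρ 0 + 2 * ∑ k ∈ Finset.range A, ρ (k + 1) :=
    ((((summable_nat_add_iff 1).2 hsum).hasSum.tendsto_sum_nat.const_mul 2).const_add _
      |>.eventually_const_lt (by change _ < κ; nlinarith)).exists
  filter_upwards [eventually_abs_weight_sub_le hσ hratio (by positivity : 0 < e / 3) A,
    eventually_forall_ge_atTop.2 (eventually_mul_scale_sq_le_scale_sub_sq hσ hratio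
      (by positivity : 0 < e / 3 * θ) A), eventually_ge_atTop 1] with l hl htail hl1 m hlm hθm
  have hm : 0 < scale σ m ^ 2 := by
    rw [scale_sq]
    exact Finset.sum_pos (fun i hi => pow_pos (hσ i (Finset.mem_Icc.1 hi).1) 2) ⟨l, by simp; omega⟩
  have hT : 0 ≤ scale σ m ^ 2 - scale σ l ^ 2 := (mul_pos hθ hm).le.trans hθm
  have hinner : (1 - e / 3) * (scale σ m ^ 2 - scale σ l ^ 2) ≤
      scale σ (m - A) ^ 2 - scale σ l ^ 2 := by
    nlinarith [htail m hlm]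
  have hinner_pos : 0 < scale σ (m - A) ^ 2 - scale σ l ^ 2 := by
    nlinarith [mul_pos hθ hm]
  have hlmA : l + A ≤ m := by
    by_contra! h
    have := pow_le_pow_left₀ (scale_nonneg _ _) (scale_mono σ (by omega : m - A ≤ l)) 2
    linarith
  have hbernoulli : 1 - e ≤ (1 - e / 3) ^ 3 := by
    have := one_add_mul_le_pow (by linarith : -2 ≤ -(e / 3)) 3
    norm_num at this
    linarith
  refine le_trans ?_ (mul_scale_sq_sub_le_blockCov hρ hσ (by positivity) hl hlmA)
  calc (1 - e) * (κ * (scale σ m ^ 2 - scale σ l ^ 2))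
      ≤ (1 - e / 3) ^ 3 * (κ * (scale σ m ^ 2 - scale σ l ^ 2)) :=
        mul_le_mul_of_nonneg_right hbernoulli (mul_nonneg hκ.le hT)
    _ = (1 - e / 3) * ((1 - e / 3) * κ) * ((1 - e / 3) * (scale σ m ^ 2 - scale σ l ^ 2)) := by
        ring
    _ ≤ _ := by
        have h1e : 0 ≤ 1 - e / 3 := by linarith
        have hpartial := (mul_nonneg h1e hκ.le).trans hA.le
        exact mul_le_mul (mul_le_mul_of_nonneg_left hA.le h1e) hinner (mul_nonneg h1e hT)
          (mul_nonneg h1e hpartial)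

end BlockVariance

/-! ### The lower bound -/

section SlepianWalk

variable {Ω : Type*} [MeasurableSpace Ω] {P : Measure Ω}

lemma stdSeq_walkNeg_le_measure {S : ℕ → Ω → ℝ} (hS : IsGaussianProcess S P)
    (hmean : ∀ k, P[S k] = 0) {c : ℕ → ℝ} (hc : 0 < c 0)
    (hvar : ∀ k, Var[S k; P] = walkSd c k ^ 2)
    (hcov : ∀ k l, k ≤ l → Var[S k; P] ≤ cov[S k, S l; P]) (n : ℕ) :
    stdSeq (walkNeg c n) ≤ P {ω | ∀ l < n, S (l + 1) ω < 0} := by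
  have hle : ∀ k l, k ≤ l → cov[walk c k, walk c l; stdSeq] ≤ cov[S k, S l; P] := fun k l hkl => by
    rw [covariance_walk, min_eq_left hkl, ← walkSd_sq, ← hvar]
    exact hcov k l hkl
  have hslepian := measure_lt_le_measure_lt_of_covariance_le
    (X := fun (l : Fin n) => walk c (l + 1)) (Y := fun (l : Fin n) => S (l + 1))
    (hasGaussianLaw_comp (isGaussianProcess_walk c) _) (hasGaussianLaw_comp hS _)
    (fun i => integral_walk c _) (fun i => hmean _)
    (fun i => by rw [variance_walk]; exact pow_pos (walkSd_pos hc _) 2)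
    (fun i => by rw [variance_walk, hvar]) (fun i j => ?_)
    fun _ => 0
  · simpa only [walkNeg, Fin.forall_iff] using hslepian
  · rcases le_total (i : ℕ) j with h | h
    · exact hle _ _ (by omega)
    · rw [covariance_comm, covariance_comm (S _)]
      exact hle _ _ (by omega)

end SlepianWalk

section Persistence

variable {Ω : Type*} [MeasurableSpace Ω] {P : Measure Ω} {ξ : ℕ → Ω → ℝ} {σ : ℕ → ℝ}

lemma covariance_eq_corr (hmean : ∀ i, P[ξ i] = 0) (hstat : IsStationary ξ P) (i j : ℕ) :
    cov[ξ i, ξ j; P] = corr ξ P (Nat.dist i j) := by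
  have hshift : ∀ i k, cov[ξ i, ξ (i + k); P] = corr ξ P k := fun i k => by
    have h := ((hstat i).comp (u := fun x : ℕ → ℝ => x 0 * x k) (by fun_prop)).integral_eq
    simp only [Function.comp_def, zero_add] at h
    simp [covariance, hmean, corr, ← h, add_comm k i]
  rcases le_total i j with h | h
  · rw [Nat.dist_eq_sub_of_le h, ← hshift i, Nat.add_sub_cancel' h]
  · rw [covariance_comm, Nat.dist_eq_sub_of_le_right h, ← hshift j, Nat.add_sub_cancel' h]

lemma covariance_sum_mul_sum_mul_eq_blockCov (hξ : IsGaussianProcess ξ P)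
    (hmean : ∀ i, P[ξ i] = 0) (hstat : IsStationary ξ P) (σ : ℕ → ℝ) (s t : Finset ℕ) :
    cov[fun ω => ∑ i ∈ s, σ i * ξ i ω, fun ω => ∑ j ∈ t, σ j * ξ j ω; P] =
      blockCov (corr ξ P) σ s t := by
  simp_rw [covariance_sum_mul_sum_mul hξ, covariance_eq_corr hmean hstat, blockCov]

lemma persistenceProb_eq (σ : ℕ → ℝ) (ξ : ℕ → Ω → ℝ) (P : Measure Ω) (n : ℕ) :
    persistenceProb σ ξ P n = P.real {ω | ∀ l < n, partialSum σ ξ (l + 1) ω < 0} := by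
  rw [persistenceProb]
  congr 1
  ext ω
  refine ⟨fun h l hl => h (l + 1) (by simp; omega), fun h l hl => ?_⟩
  rw [Finset.mem_Icc] at hl
  simpa [Nat.sub_add_cancel hl.1] using h (l - 1) (by omega)

/-- The standard deviations of the increments of the walk with independent Gaussian increments
whose variances are those of the weighted partial sums. -/
noncomputable def incrementSd (ρ σ : ℕ → ℝ) (k : ℕ) : ℝ :=
  √(blockCov ρ σ (Finset.Icc 1 (k + 1)) (Finset.Icc 1 (k + 1)) -
    blockCov ρ σ (Finset.Icc 1 k) (Finset.Icc 1 k))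

lemma walkSd_incrementSd_sq {ρ : ℕ → ℝ} (hρ : ∀ i, 0 ≤ ρ i) (hσ : ∀ i, 1 ≤ i → 0 ≤ σ i) (k : ℕ) :
    walkSd (incrementSd ρ σ) k ^ 2 = blockCov ρ σ (Finset.Icc 1 k) (Finset.Icc 1 k) := by
  have hmono : ∀ i, blockCov ρ σ (Finset.Icc 1 i) (Finset.Icc 1 i) ≤
      blockCov ρ σ (Finset.Icc 1 (i + 1)) (Finset.Icc 1 (i + 1)) := fun i =>
    have hsub := Finset.Icc_subset_Icc_right (a := 1) i.le_succ
    have hnonneg := fun j hj => hσ j (Finset.mem_Icc.1 hj).1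
    blockCov_mono hρ hsub hsub hnonneg hnonneg
  simp_rw [walkSd_sq, incrementSd, Real.sq_sqrt (sub_nonneg.2 (hmono _))]
  rw [Finset.sum_range_sub fun i => blockCov ρ σ (Finset.Icc 1 i) (Finset.Icc 1 i)]
  simp [blockCov]

lemma stdSeq_walkNeg_incrementSd_le_persistenceProb (hξ : IsGaussianProcess ξ P)
    (hmean : ∀ i, P[ξ i] = 0) (hstat : IsStationary ξ P) (hρ : ∀ i, 0 ≤ corr ξ P i)
    (hσ : ∀ i, 1 ≤ i → 0 ≤ σ i) (hpos : 0 < incrementSd (corr ξ P) σ 0) (n : ℕ) :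
    stdSeq.real (walkNeg (incrementSd (corr ξ P) σ) n) ≤ persistenceProb σ ξ P n := by
  have := hξ.isProbabilityMeasure
  have hcov : ∀ k l, cov[partialSum σ ξ k, partialSum σ ξ l; P] =
      blockCov (corr ξ P) σ (Finset.Icc 1 k) (Finset.Icc 1 l) := fun k l =>
    covariance_sum_mul_sum_mul_eq_blockCov hξ hmean hstat σ _ _
  have hS : IsGaussianProcess (partialSum σ ξ) P :=
    isGaussianProcess_sum_mul hξ (fun k => Finset.Icc 1 k) fun _ => σ
  have hvar : ∀ k, Var[partialSum σ ξ k; P] =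
      blockCov (corr ξ P) σ (Finset.Icc 1 k) (Finset.Icc 1 k) := fun k => by
    rw [← hcov, covariance_self (hS.hasGaussianLaw_eval k).aemeasurable]
  rw [persistenceProb_eq]
  refine ENNReal.toReal_mono (measure_ne_top _ _) <| stdSeq_walkNeg_le_measure hS
    (fun k => integral_sum_mul hξ hmean _ σ) hpos
    (fun k => by rw [hvar, walkSd_incrementSd_sq hρ hσ]) (fun k l hkl => ?_) n
  rw [hvar, hcov]
  exact blockCov_mono hρ subset_rfl (Finset.Icc_subset_Icc_right hkl)
    (fun i hi => hσ i (Finset.mem_Icc.1 hi).1) fun i hi => hσ i (Finset.mem_Icc.1 hi).1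

lemma exists_div_scale_le_persistenceProb (hξ : IsGaussianProcess ξ P)
    (hmean : ∀ i, P[ξ i] = 0) (hstat : IsStationary ξ P) (hρ : ∀ i, 0 ≤ corr ξ P i)
    (hρ0 : 0 < corr ξ P 0) (hsum : Summable (corr ξ P)) (hσ : ∀ i, 1 ≤ i → 0 < σ i)
    (hs : Tendsto (scale σ) atTop atTop) :
    ∃ K > 0, ∀ᶠ n in atTop, K / scale σ n ≤ persistenceProb σ ξ P n := by
  set c := incrementSd (corr ξ P) σ
  have hvar := walkSd_incrementSd_sq (ρ := corr ξ P) hρ fun i hi => (hσ i hi).le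
  have hc : 0 < c 0 := Real.sqrt_pos.2 <| by
    simpa [blockCov, Nat.dist] using mul_pos (mul_pos (hσ 1 le_rfl) (hσ 1 le_rfl)) hρ0
  have hκ : 0 < totalCorr (corr ξ P) := hρ0.trans_le (le_totalCorr hρ)
  set κ := totalCorr (corr ξ P)
  obtain ⟨K, hK, hwalk⟩ := exists_le_stdSeq_real_walkNeg
  refine ⟨K * (c 0 / √κ), by positivity, ?_⟩
  filter_upwards [((tendsto_pow_atTop two_ne_zero).comp hs).eventually_ge_atTop
    (2 * c 0 ^ 2 / corr ξ P 0), eventually_ge_atTop 1] with n hn hn1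
  obtain ⟨m, rfl⟩ := Nat.exists_eq_add_of_le' hn1
  have hlower : 2 * c 0 ^ 2 ≤ walkSd c (m + 1) ^ 2 := by
    rw [hvar]
    refine ((div_le_iff₀' hρ0).1 hn).trans ?_
    simp only [Function.comp_apply, scale_sq]
    exact mul_sum_sq_le_blockCov_self hρ fun i hi => (hσ i (Finset.mem_Icc.1 hi).1).le
  have hupper : walkSd c (m + 1) ≤ √κ * scale σ (m + 1) := by
    refine le_of_sq_le_sq ?_ (by have := scale_nonneg σ (m + 1); positivity)
    rw [hvar, mul_pow, Real.sq_sqrt hκ.le, scale_sq]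
    exact blockCov_self_le hρ hsum _
  calc K * (c 0 / √κ) / scale σ (m + 1) = K * (c 0 / (√κ * scale σ (m + 1))) := by
        rw [mul_div_assoc, div_div]
    _ ≤ K * (c 0 / walkSd c (m + 1)) := by
        have := walkSd_pos hc m
        gcongr
    _ ≤ stdSeq.real (walkNeg c (m + 1)) := hwalk c m hc hlower
    _ ≤ persistenceProb σ ξ P (m + 1) := stdSeq_walkNeg_incrementSd_le_persistenceProb hξ hmean
        hstat hρ (fun i hi => (hσ i hi).le) hc _

end Persistence

/-! ### Sampling times -/

section Sampling

variable {ρ σ : ℕ → ℝ}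

/-- `t` is a sequence of sampling times for the upper bound: from `t 1` on, the squared scale grows
by factors between `1 + η / 2` and `1 + η`, and the variance of the weighted sum over each block
`(t k, t (k + 1)]` is at least `1 - e` times its upper bound `totalCorr ρ * ∑ σ i ^ 2`. -/
structure IsSampling (ρ σ : ℕ → ℝ) (e η : ℝ) (t : ℕ → ℕ) : Prop where
  zero : t 0 = 0
  strictMono : StrictMono t
  one_le_scale : 1 ≤ scale σ (t 1)
  growth_le : ∀ k, (1 + η / 2) * scale σ (t (k + 1)) ^ 2 ≤ scale σ (t (k + 2)) ^ 2
  le_growth : ∀ k, scale σ (t (k + 2)) ^ 2 ≤ (1 + η) * scale σ (t (k + 1)) ^ 2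
  le_blockCov : ∀ k, (1 - e) * (totalCorr ρ * (scale σ (t (k + 1)) ^ 2 - scale σ (t k) ^ 2)) ≤
    blockCov ρ σ (Finset.Ioc (t k) (t (k + 1))) (Finset.Ioc (t k) (t (k + 1)))

lemma scale_pos (hσ : ∀ i, 1 ≤ i → 0 < σ i) {n : ℕ} (hn : 1 ≤ n) : 0 < scale σ n :=
  Real.sqrt_pos.2 <| Finset.sum_pos (fun i hi => pow_pos (hσ i (Finset.mem_Icc.1 hi).1) 2)
    ⟨1, Finset.left_mem_Icc.2 hn⟩

lemma eventually_exists_scale_sq_mem_Icc (hσ : ∀ i, 1 ≤ i → 0 < σ i)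
    (hs : Tendsto (scale σ) atTop atTop)
    (hratio : ∀ l : ℕ, 1 ≤ l → Tendsto (fun n => σ (n + l) / σ n) atTop (𝓝 1))
    {η : ℝ} (hη : 0 < η) (hη1 : η ≤ 1) :
    ∀ᶠ m in atTop, ∃ m' > m,
      scale σ m' ^ 2 ∈ Set.Icc ((1 + η / 2) * scale σ m ^ 2) ((1 + η) * scale σ m ^ 2) := by
  obtain ⟨N, hN⟩ := eventually_atTop.1
    (eventually_weight_sq_le hσ hratio (by positivity : 0 < η / 8))
  filter_upwards [eventually_ge_atTop (N + 1)] with m hm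
  have hpos := pow_pos (scale_pos hσ (by omega : 1 ≤ m)) 2
  have hex : ∃ n, (1 + η / 2) * scale σ m ^ 2 ≤ scale σ n ^ 2 :=
    (((tendsto_pow_atTop two_ne_zero).comp hs).eventually_ge_atTop _).exists
  classical
  set m' := Nat.find hex
  have hspec : (1 + η / 2) * scale σ m ^ 2 ≤ scale σ m' ^ 2 := Nat.find_spec hex
  have hlt : m < m' := by
    by_contra! h
    nlinarith [pow_le_pow_left₀ (scale_nonneg σ m') (scale_mono σ h) 2]
  have hmin : scale σ (m' - 1) ^ 2 < (1 + η / 2) * scale σ m ^ 2 :=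
    not_le.1 (Nat.find_min hex (m := m' - 1) (by omega))
  have hjump : scale σ m' ^ 2 - scale σ (m' - 1) ^ 2 ≤ η / 8 * scale σ m' ^ 2 := by
    have hIoc : Finset.Ioc (m' - 1) m' = {m'} := by ext; simp; omega
    rw [scale_sq_sub σ (Nat.sub_le m' 1), hIoc, Finset.sum_singleton]
    exact hN m' (by omega)
  refine ⟨m', hlt, hspec, le_of_mul_le_mul_left (a := 1 - η / 8) ?_ (by linarith)⟩
  calc (1 - η / 8) * scale σ m' ^ 2 ≤ (1 + η / 2) * scale σ m ^ 2 := by linarith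
    _ ≤ (1 - η / 8) * ((1 + η) * scale σ m ^ 2) := by
      nlinarith [mul_nonneg hη.le (sub_nonneg.2 hη1)]

lemma eventually_le_blockCov_Ioc_zero (hρ : ∀ i, 0 ≤ ρ i) (hρ0 : 0 < ρ 0) (hsum : Summable ρ)
    (hσ : ∀ i, 1 ≤ i → 0 < σ i) (hs : Tendsto (scale σ) atTop atTop)
    (hratio : ∀ l : ℕ, 1 ≤ l → Tendsto (fun n => σ (n + l) / σ n) atTop (𝓝 1))
    {e : ℝ} (he : 0 < e) (he1 : e ≤ 1) :
    ∀ᶠ m in atTop, (1 - e) * (totalCorr ρ * scale σ m ^ 2) ≤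
      blockCov ρ σ (Finset.Ioc 0 m) (Finset.Ioc 0 m) := by
  obtain ⟨L, hL⟩ := (eventually_le_blockCov hρ hρ0 hsum hσ hratio (half_pos he) (by linarith)
    (half_pos one_pos)).exists
  filter_upwards [((tendsto_pow_atTop two_ne_zero).comp hs).eventually_ge_atTop
    (2 / e * scale σ L ^ 2), eventually_ge_atTop L] with m hm hLm
  have hκ : 0 ≤ totalCorr ρ := hρ0.le.trans (le_totalCorr hρ)
  have hinitial : scale σ L ^ 2 ≤ e / 2 * scale σ m ^ 2 := by
    have := mul_le_mul_of_nonneg_left hm (half_pos he).le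
    rwa [← mul_assoc, div_mul_div_cancel₀ two_ne_zero, div_self he.ne', one_mul] at this
  have hpos : ∀ i ∈ Finset.Ioc 0 m, 0 ≤ σ i := fun i hi => (hσ i (Finset.mem_Ioc.1 hi).1).le
  have hsub : Finset.Ioc L m ⊆ Finset.Ioc 0 m := Finset.Ioc_subset_Ioc_left (Nat.zero_le L)
  calc (1 - e) * (totalCorr ρ * scale σ m ^ 2)
      ≤ (1 - e / 2) * (totalCorr ρ * ((1 - e / 2) * scale σ m ^ 2)) := by
        nlinarith [mul_nonneg (sq_nonneg e) (mul_nonneg hκ (sq_nonneg (scale σ m)))]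
    _ ≤ (1 - e / 2) * (totalCorr ρ * (scale σ m ^ 2 - scale σ L ^ 2)) := by
        have : 0 ≤ 1 - e / 2 := by linarith
        gcongr
        linarith
    _ ≤ blockCov ρ σ (Finset.Ioc L m) (Finset.Ioc L m) :=
        hL m hLm (by nlinarith [sq_nonneg (scale σ m)])
    _ ≤ blockCov ρ σ (Finset.Ioc 0 m) (Finset.Ioc 0 m) := blockCov_mono hρ hsub hsub hpos hpos

lemma exists_isSampling (hρ : ∀ i, 0 ≤ ρ i) (hρ0 : 0 < ρ 0) (hsum : Summable ρ)
    (hσ : ∀ i, 1 ≤ i → 0 < σ i) (hs : Tendsto (scale σ) atTop atTop)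
    (hratio : ∀ l : ℕ, 1 ≤ l → Tendsto (fun n => σ (n + l) / σ n) atTop (𝓝 1))
    {e η : ℝ} (he : 0 < e) (he1 : e ≤ 1) (hη : 0 < η) (hη1 : η ≤ 1) :
    ∃ t, IsSampling ρ σ e η t := by
  have hnext : ∀ᶠ m in atTop, ∃ m' > m,
      scale σ m' ^ 2 ∈ Set.Icc ((1 + η / 2) * scale σ m ^ 2) ((1 + η) * scale σ m ^ 2) ∧
        (1 - e) * (totalCorr ρ * (scale σ m' ^ 2 - scale σ m ^ 2)) ≤
          blockCov ρ σ (Finset.Ioc m m') (Finset.Ioc m m') := by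
    filter_upwards [eventually_exists_scale_sq_mem_Icc hσ hs hratio hη hη1,
      eventually_le_blockCov hρ hρ0 hsum hσ hratio he he1 (θ := η / 4) (by positivity)]
      with m ⟨m', hlt, hmem⟩ hblock
    exact ⟨m', hlt, hmem, hblock m' hlt.le (by nlinarith [hmem.1, hmem.2, sq_nonneg (scale σ m)])⟩
  obtain ⟨N, hN⟩ := eventually_atTop.1 hnext
  choose! next hlt hgrowth hblock using hN
  obtain ⟨M, hMfirst, hM1, hNM⟩ :=
    ((eventually_le_blockCov_Ioc_zero hρ hρ0 hsum hσ hs hratio he he1).and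
      ((hs.eventually_ge_atTop 1).and (eventually_ge_atTop (N + 1)))).exists
  have hle : ∀ k, N + 1 ≤ next^[k] M := fun k => by
    induction k with
    | zero => exact hNM
    | succ k ih =>
      rw [Function.iterate_succ_apply']
      exact ih.trans (hlt _ (by omega)).le
  have hN' : ∀ k, next^[k] M ≥ N := fun k => (Nat.le_succ N).trans (hle k)
  refine ⟨fun k => Nat.casesOn k 0 fun k => next^[k] M, rfl,
    strictMono_nat_of_lt_succ fun k => ?_, hM1, fun k => ?_, fun k => ?_, fun k => ?_⟩
  · rcases k with _ | k
    · exact N.succ_pos.trans_le (hle 0)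
    · simpa only [Function.iterate_succ_apply'] using hlt _ (hN' k)
  · simpa only [Function.iterate_succ_apply'] using (hgrowth _ (hN' k)).1
  · simpa only [Function.iterate_succ_apply'] using (hgrowth _ (hN' k)).2
  · rcases k with _ | k
    · simpa [scale] using hMfirst
    · simpa only [Function.iterate_succ_apply'] using hblock _ (hN' k)

end Sampling

/-! ### The upper bound -/

section Blocks

variable {σ : ℕ → ℝ} {t : ℕ → ℕ}

/-- The norm of the weights in the block `(t k, t (k + 1)]`. -/
noncomputable def blockSd (σ : ℕ → ℝ) (t : ℕ → ℕ) (k : ℕ) : ℝ :=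
  √(∑ i ∈ Finset.Ioc (t k) (t (k + 1)), σ i ^ 2)

lemma blockSd_sq (σ : ℕ → ℝ) (t : ℕ → ℕ) (k : ℕ) :
    blockSd σ t k ^ 2 = ∑ i ∈ Finset.Ioc (t k) (t (k + 1)), σ i ^ 2 :=
  Real.sq_sqrt (Finset.sum_nonneg fun _ _ => sq_nonneg _)

lemma blockSd_pos (hσ : ∀ i, 1 ≤ i → 0 < σ i) (ht : StrictMono t) (k : ℕ) : 0 < blockSd σ t k :=
  Real.sqrt_pos.2 <| Finset.sum_pos
    (fun i hi => pow_pos (hσ i (Nat.one_le_of_lt (Finset.mem_Ioc.1 hi).1)) 2)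
    ⟨t (k + 1), Finset.right_mem_Ioc.2 (ht k.lt_succ_self)⟩

lemma sum_range_sum_Ioc {M : Type*} [AddCommMonoid M] (ht : Monotone t) (f : ℕ → M) (n : ℕ) :
    ∑ k ∈ Finset.range n, ∑ i ∈ Finset.Ioc (t k) (t (k + 1)), f i =
      ∑ i ∈ Finset.Ioc (t 0) (t n), f i := by
  induction n with
  | zero => simp
  | succ n ih =>
    rw [Finset.sum_range_succ, ih, Finset.sum_Ioc_consecutive _ (ht n.zero_le) (ht n.le_succ)]

lemma walkSd_blockSd (σ : ℕ → ℝ) (ht : Monotone t) (ht0 : t 0 = 0) (k : ℕ) :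
    walkSd (blockSd σ t) k = scale σ (t k) := by
  simp_rw [walkSd, blockSd_sq]
  rw [sum_range_sum_Ioc ht, ht0, ← Finset.Icc_succ_left_eq_Ioc]
  rfl

lemma exists_eq_on_Ioc (ht : Monotone t) (x : ℕ → ℝ) :
    ∃ z : ℕ → ℝ, ∀ k, ∀ i ∈ Finset.Ioc (t k) (t (k + 1)), z i = x k := by
  classical
  refine ⟨fun i => if h : ∃ k, i ∈ Finset.Ioc (t k) (t (k + 1)) then x h.choose else 0,
    fun k i hi => ?_⟩
  have hex : ∃ k, i ∈ Finset.Ioc (t k) (t (k + 1)) := ⟨k, hi⟩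
  have huniq : hex.choose = k := by
    by_contra hne
    exact Set.disjoint_left.1 (ht.pairwise_disjoint_on_Ioc_succ hne)
      (Finset.mem_Ioc.1 hex.choose_spec) (Finset.mem_Ioc.1 hi)
  exact (dif_pos hex).trans (congrArg x huniq)

end Blocks

section NormalizedBlocks

variable {Ω : Type*} [MeasurableSpace Ω] {P : Measure Ω} {ξ : ℕ → Ω → ℝ} {σ : ℕ → ℝ} {t : ℕ → ℕ}
  {κ : ℝ}

/-- The weighted sum over the block `(t k, t (k + 1)]`, divided by `√κ` times the norm of the
weights; for `κ = totalCorr ρ` its variance is at most, and asymptotically equal to, one. -/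
noncomputable def normalizedBlock {Ω : Type*} (κ : ℝ) (σ : ℕ → ℝ) (ξ : ℕ → Ω → ℝ) (t : ℕ → ℕ)
    (k : ℕ) (ω : Ω) : ℝ :=
  (√κ * blockSd σ t k)⁻¹ * ∑ i ∈ Finset.Ioc (t k) (t (k + 1)), σ i * ξ i ω

lemma isGaussianProcess_normalizedBlock (hξ : IsGaussianProcess ξ P) (κ : ℝ) (σ : ℕ → ℝ)
    (t : ℕ → ℕ) : IsGaussianProcess (normalizedBlock κ σ ξ t) P := by
  have := isGaussianProcess_sum_mul hξ (fun k => Finset.Ioc (t k) (t (k + 1)))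
    fun k i => (√κ * blockSd σ t k)⁻¹ * σ i
  simp only [mul_assoc, ← Finset.mul_sum] at this
  exact this

lemma integral_normalizedBlock (hξ : IsGaussianProcess ξ P) (hmean : ∀ i, P[ξ i] = 0) (k : ℕ) :
    P[normalizedBlock κ σ ξ t k] = 0 := by
  simp_rw [normalizedBlock, integral_const_mul, integral_sum_mul hξ hmean, mul_zero]

lemma covariance_normalizedBlock (hξ : IsGaussianProcess ξ P) (hmean : ∀ i, P[ξ i] = 0)
    (hstat : IsStationary ξ P) (k l : ℕ) :
    cov[normalizedBlock κ σ ξ t k, normalizedBlock κ σ ξ t l; P] =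
      (√κ * blockSd σ t k)⁻¹ * ((√κ * blockSd σ t l)⁻¹ *
        blockCov (corr ξ P) σ (Finset.Ioc (t k) (t (k + 1))) (Finset.Ioc (t l) (t (l + 1)))) := by
  rw [← covariance_sum_mul_sum_mul_eq_blockCov hξ hmean hstat, ← covariance_const_mul_right,
    ← covariance_const_mul_left]
  rfl

omit [MeasurableSpace Ω] in
lemma walk_blockSd_normalizedBlock (hσ : ∀ i, 1 ≤ i → 0 < σ i) (ht : StrictMono t)
    (ht0 : t 0 = 0) (n : ℕ) (ω : Ω) :
    walk (blockSd σ t) n (fun k => normalizedBlock κ σ ξ t k ω) =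
      (√κ)⁻¹ * partialSum σ ξ (t n) ω := by
  have hblock : ∀ k, blockSd σ t k * normalizedBlock κ σ ξ t k ω =
      (√κ)⁻¹ * ∑ i ∈ Finset.Ioc (t k) (t (k + 1)), σ i * ξ i ω := fun k => by
    rw [normalizedBlock, mul_inv, mul_comm (√κ)⁻¹, ← mul_assoc, ← mul_assoc,
      mul_inv_cancel₀ (blockSd_pos hσ ht k).ne', one_mul]
  simp_rw [walk, hblock]
  rw [← Finset.mul_sum, sum_range_sum_Ioc ht.monotone, ht0, partialSum,
    ← Finset.Icc_succ_left_eq_Ioc]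
  rfl

lemma variance_sum_mul_normalizedBlock_le (hξ : IsGaussianProcess ξ P)
    (hmean : ∀ i, P[ξ i] = 0) (hstat : IsStationary ξ P) (hρ : ∀ i, 0 ≤ corr ξ P i)
    (hρ0 : 0 < corr ξ P 0) (hsum : Summable (corr ξ P)) (hσ : ∀ i, 1 ≤ i → 0 < σ i)
    (ht : StrictMono t) (n : ℕ) (x : ℕ → ℝ) :
    Var[fun ω => ∑ k ∈ Finset.range n, x k * normalizedBlock (totalCorr (corr ξ P)) σ ξ t k ω; P] ≤
      ∑ k ∈ Finset.range n, x k ^ 2 := by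
  set κ := totalCorr (corr ξ P)
  have hκ : 0 < κ := hρ0.trans_le (le_totalCorr hρ)
  obtain ⟨z, hz⟩ := exists_eq_on_Ioc ht.monotone fun k => x k * (√κ * blockSd σ t k)⁻¹
  have hflat : ∀ ω, ∑ k ∈ Finset.range n, x k * normalizedBlock κ σ ξ t k ω =
      ∑ i ∈ Finset.Ioc (t 0) (t n), z i * σ i * ξ i ω := fun ω => by
    rw [← sum_range_sum_Ioc ht.monotone]
    refine Finset.sum_congr rfl fun k _ => ?_
    rw [normalizedBlock, ← mul_assoc, Finset.mul_sum]
    exact Finset.sum_congr rfl fun i hi => by rw [hz k i hi, mul_assoc _ (σ i)]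
  have hblock : ∀ k, κ * ∑ i ∈ Finset.Ioc (t k) (t (k + 1)), (z i * σ i) ^ 2 = x k ^ 2 :=
    fun k => by
      have hsd := blockSd_pos hσ ht k
      rw [Finset.sum_congr rfl fun i hi => by rw [hz k i hi, mul_pow], ← Finset.mul_sum,
        ← blockSd_sq, mul_pow, inv_pow, mul_pow, Real.sq_sqrt hκ.le]
      field_simp
  have hmeas := (isGaussianProcess_sum_mul hξ (fun _ : Unit => Finset.Ioc (t 0) (t n))
    fun _ i => z i * σ i).hasGaussianLaw_eval ()
  simp_rw [hflat]
  calc _ = blockCov (corr ξ P) (fun i => z i * σ i) (Finset.Ioc (t 0) (t n))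
          (Finset.Ioc (t 0) (t n)) := by
        rw [← covariance_self hmeas.aemeasurable,
          ← covariance_sum_mul_sum_mul_eq_blockCov hξ hmean hstat]
    _ ≤ κ * ∑ i ∈ Finset.Ioc (t 0) (t n), (z i * σ i) ^ 2 := blockCov_self_le hρ hsum _
    _ = ∑ k ∈ Finset.range n, x k ^ 2 := by
        simp_rw [← sum_range_sum_Ioc ht.monotone, Finset.mul_sum (Finset.range n), hblock]

end NormalizedBlocks

section UpperBound

variable {Ω : Type*} [MeasurableSpace Ω] {P : Measure Ω} {ξ : ℕ → Ω → ℝ} {ρ σ : ℕ → ℝ}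
  {t : ℕ → ℕ} {e η δ : ℝ}

lemma persistenceProb_le_mul_stdSeq (hξ : IsGaussianProcess ξ P)
    (hmean : ∀ i, P[ξ i] = 0) (hstat : IsStationary ξ P) (hρ : ∀ i, 0 ≤ corr ξ P i)
    (hρ0 : 0 < corr ξ P 0) (hsum : Summable (corr ξ P)) (hσ : ∀ i, 1 ≤ i → 0 < σ i)
    (ht : IsSampling (corr ξ P) σ e η t) (he : e < 1 / 2) {N n : ℕ} (hN : t N ≤ n) :
    persistenceProb σ ξ P n ≤ (√(1 - 2 * e))⁻¹ ^ N * stdSeq.real (walkNeg (blockSd σ t) N) := by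
  have := hξ.isProbabilityMeasure
  set κ := totalCorr (corr ξ P)
  have hκ : 0 < κ := hρ0.trans_le (le_totalCorr hρ)
  have hsd := blockSd_pos hσ ht.strictMono
  have hpos : ∀ k, ∀ i ∈ Finset.Ioc (t k) (t (k + 1)), 0 ≤ σ i := fun k i hi =>
    (hσ i (Nat.one_le_of_lt (Finset.mem_Ioc.1 hi).1)).le
  have hX := isGaussianProcess_normalizedBlock hξ κ σ t
  have hcov : ∀ k l, 0 ≤ cov[normalizedBlock κ σ ξ t k, normalizedBlock κ σ ξ t l; P] :=
    fun k l => by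
      have hblock := blockCov_nonneg hρ (hpos k) (hpos l)
      have hk := hsd k
      have hl := hsd l
      rw [covariance_normalizedBlock hξ hmean hstat]
      positivity
  have hvar : ∀ k, 1 - e ≤ Var[normalizedBlock κ σ ξ t k; P] := fun k => by
    have hblock := ht.le_blockCov k
    rw [scale_sq_sub σ (ht.strictMono.monotone k.le_succ), ← blockSd_sq] at hblock
    rwa [← covariance_self (hX.hasGaussianLaw_eval k).aemeasurable,
      covariance_normalizedBlock hξ hmean hstat, ← mul_assoc, ← mul_inv, ← sq, mul_pow,
      Real.sq_sqrt hκ.le, inv_mul_eq_div, le_div_iff₀ (mul_pos hκ (pow_pos (hsd k) 2))]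
  have hle := measure_walkNeg_le_mul_stdSeq hX (integral_normalizedBlock hξ hmean) he hcov hvar
    (variance_sum_mul_normalizedBlock_le hξ hmean hstat hρ hρ0 hsum hσ ht.strictMono)
    (blockSd σ t) N
  have hsub : {ω | ∀ l < n, partialSum σ ξ (l + 1) ω < 0} ⊆
      {ω | (fun k => normalizedBlock κ σ ξ t k ω) ∈ walkNeg (blockSd σ t) N} := fun ω hω l hl => by
    have htl : 0 < t (l + 1) := ht.zero ▸ ht.strictMono l.succ_pos
    have htN : t (l + 1) ≤ t N := ht.strictMono.monotone (Nat.succ_le_of_lt hl)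
    have hneg := hω (t (l + 1) - 1) (by omega)
    rw [Nat.sub_add_cancel htl] at hneg
    rw [walk_blockSd_normalizedBlock hσ ht.strictMono ht.zero]
    exact mul_neg_of_pos_of_neg (inv_pos.2 (Real.sqrt_pos.2 hκ)) hneg
  have hreal := ENNReal.toReal_mono (by finiteness) ((measure_mono hsub).trans hle)
  rwa [ENNReal.toReal_mul, ENNReal.toReal_pow, ENNReal.toReal_ofReal (by positivity),
    ← measureReal_def, ← persistenceProb_eq] at hreal

lemma IsSampling.one_le_scale_succ (ht : IsSampling ρ σ e η t) (N : ℕ) :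
    1 ≤ scale σ (t (N + 1)) :=
  ht.one_le_scale.trans (scale_mono σ (ht.strictMono.monotone (by omega)))

lemma IsSampling.exp_mul_le_scale_pow (ht : IsSampling ρ σ e η t) (hη : 0 ≤ η) (hη1 : η ≤ 1)
    (N : ℕ) : Real.exp (N * η) ≤ scale σ (t (N + 1)) ^ 8 := by
  have hgeom : (1 + η / 2) ^ N ≤ scale σ (t (N + 1)) ^ 2 := by
    induction N with
    | zero =>
      rw [pow_zero]
      exact one_le_pow₀ ht.one_le_scale
    | succ N ih =>
      rw [pow_succ']
      exact (mul_le_mul_of_nonneg_left ih (by positivity)).trans (ht.growth_le N)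
  have hexp : Real.exp (η / 4) ≤ 1 + η / 2 := by
    rw [← Real.le_log_iff_exp_le (by positivity)]
    refine le_trans ?_ (Real.le_log_one_add_of_nonneg (by positivity))
    rw [le_div_iff₀ (by positivity)]
    nlinarith
  calc Real.exp (N * η) = ((Real.exp (η / 4)) ^ N) ^ 4 := by
        rw [← Real.exp_nat_mul, ← Real.exp_nat_mul]
        congr 1
        push_cast
        ring
    _ ≤ (scale σ (t (N + 1)) ^ 2) ^ 4 := by
        gcongr
        exact (pow_le_pow_left₀ (Real.exp_pos _).le hexp N).trans hgeom
    _ = scale σ (t (N + 1)) ^ 8 := by rw [← pow_mul]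

lemma IsSampling.exists_mem_Ico (ht : IsSampling ρ σ e η t) {n : ℕ} (hn : t 1 ≤ n) :
    ∃ N, n ∈ Set.Ico (t (N + 1)) (t (N + 2)) := by
  induction n, hn using Nat.le_induction with
  | base => exact ⟨0, le_rfl, ht.strictMono (by omega)⟩
  | succ n _ ih =>
    obtain ⟨N, hlower, hupper⟩ := ih
    rcases (Nat.succ_le_of_lt hupper).lt_or_eq with h | h
    · exact ⟨N, by omega, h⟩
    · exact ⟨N + 1, h.ge, by
        rw [show n + 1 = t (N + 2) from h]
        exact ht.strictMono (by omega)⟩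

lemma IsSampling.scale_le_two_mul (ht : IsSampling ρ σ e η t) (hη1 : η ≤ 1) {N n : ℕ}
    (hn : n < t (N + 2)) : scale σ n ≤ 2 * scale σ (t (N + 1)) := by
  have hs := scale_nonneg σ (t (N + 1))
  refine (scale_mono σ hn.le).trans (le_of_sq_le_sq ?_ (by positivity))
  nlinarith [ht.le_growth N]

lemma IsSampling.blockSd_succ_le (ht : IsSampling ρ σ e η t) (hη : 0 ≤ η) (k : ℕ) :
    blockSd σ t (k + 1) ≤ √η * scale σ (t (k + 1)) := by
  refine le_of_sq_le_sq ?_ (mul_nonneg (Real.sqrt_nonneg _) (scale_nonneg _ _))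
  rw [mul_pow, Real.sq_sqrt hη, blockSd_sq,
    ← scale_sq_sub σ (ht.strictMono.monotone (Nat.le_succ _))]
  linarith [ht.le_growth k]

lemma IsSampling.exp_pow_mul_exp_pow_le_rpow (ht : IsSampling ρ σ e η t) (hδ : 0 ≤ δ)
    (hη : 0 ≤ η) (hη1 : η ≤ 1) {N n : ℕ} (hn : t (N + 1) ≤ n) :
    Real.exp (δ * η) ^ N * Real.exp (δ * η) ^ N ≤ scale σ n ^ (16 * δ) := by
  calc Real.exp (δ * η) ^ N * Real.exp (δ * η) ^ N = Real.exp (N * η) ^ (2 * δ) := by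
        rw [← Real.exp_nat_mul, ← Real.exp_add, ← Real.exp_mul]
        congr 1
        ring
    _ ≤ (scale σ n ^ 8) ^ (2 * δ) := by
        gcongr
        exact (ht.exp_mul_le_scale_pow hη hη1 N).trans
          (pow_le_pow_left₀ (scale_nonneg _ _) (scale_mono σ hn) 8)
    _ = scale σ n ^ (16 * δ) := by
        rw [← Real.rpow_natCast, ← Real.rpow_mul (scale_nonneg _ _)]
        congr 1
        push_cast
        ring

lemma IsSampling.persistenceProb_le_rpow (ht : IsSampling (corr ξ P) σ e η t)
    (hξ : IsGaussianProcess ξ P) (hmean : ∀ i, P[ξ i] = 0) (hstat : IsStationary ξ P)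
    (hρ : ∀ i, 0 ≤ corr ξ P i) (hρ0 : 0 < corr ξ P 0) (hsum : Summable (corr ξ P))
    (hσ : ∀ i, 1 ≤ i → 0 < σ i) (hδ : 0 < δ) (hη : 0 < η) (hη1 : η ≤ 1)
    (hQ : η ≤ (gaussianReal 0 1).real (Set.Ioi (1 / δ)))
    (he : 1 - 2 * e = Real.exp (-(δ * η)) ^ 2) {n : ℕ} (hn : t 1 ≤ n) :
    persistenceProb σ ξ P n ≤ 2 * Real.exp (δ * η) * ((1 + √η) * blockSd σ t 0 / √η) *
      scale σ n ^ (16 * δ - 1) := by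
  obtain ⟨N, hlower, hupper⟩ := ht.exists_mem_Ico hn
  have hsd := blockSd_pos hσ ht.strictMono
  have hwalkSd := walkSd_blockSd σ ht.strictMono.monotone ht.zero
  have hone := ht.one_le_scale_succ N
  have hspos : 0 < scale σ n := by linarith [scale_mono σ hlower]
  have hincr : ∀ k, blockSd σ t (k + 1) ≤ √η * walkSd (blockSd σ t) (k + 1) := fun k =>
    hwalkSd (k + 1) ▸ ht.blockSd_succ_le hη.le k
  have hwalk := stdSeq_real_walkNeg_le hsd hδ (Real.sqrt_pos.2 hη) hincr
    (by rwa [Real.sq_sqrt hη.le]) N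
  rw [hwalkSd, Real.sq_sqrt hη.le] at hwalk
  have hcompare := persistenceProb_le_mul_stdSeq hξ hmean hstat hρ hρ0 hsum hσ ht
    (by have := pow_pos (Real.exp_pos (-(δ * η))) 2; linarith) hlower
  rw [he, Real.sqrt_sq (Real.exp_pos _).le, Real.exp_neg, inv_inv] at hcompare
  set K := (1 + √η) * blockSd σ t 0 / √η with hK_def
  have hK : 0 < K := by have := hsd 0; positivity
  have hexp := ht.exp_pow_mul_exp_pow_le_rpow hδ.le hη.le hη1 hlower
  calc persistenceProb σ ξ P n
      ≤ Real.exp (δ * η) ^ (N + 1) * ((1 + δ * η) ^ N * ((1 + √η) * blockSd σ t 0) /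
          (√η * scale σ (t (N + 1)))) := hcompare.trans (by gcongr)
    _ = Real.exp (δ * η) * (Real.exp (δ * η) ^ N * (1 + δ * η) ^ N) *
          (K / scale σ (t (N + 1))) := by
        rw [hK_def]
        field_simp
        ring
    _ ≤ Real.exp (δ * η) * (Real.exp (δ * η) ^ N * Real.exp (δ * η) ^ N) *
          (2 * K / scale σ n) := by
        gcongr ?_ * (_ * ?_ ^ N) * ?_
        · linarith [Real.add_one_le_exp (δ * η)]
        · rw [div_le_div_iff₀ (by linarith) hspos]
          nlinarith [ht.scale_le_two_mul hη1 hupper]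
    _ ≤ Real.exp (δ * η) * scale σ n ^ (16 * δ) * (2 * K / scale σ n) := by gcongr
    _ = 2 * Real.exp (δ * η) * K * scale σ n ^ (16 * δ - 1) := by
        rw [Real.rpow_sub_one hspos.ne']
        ring

lemma exists_persistenceProb_le_rpow (hξ : IsGaussianProcess ξ P)
    (hmean : ∀ i, P[ξ i] = 0) (hstat : IsStationary ξ P) (hρ : ∀ i, 0 ≤ corr ξ P i)
    (hρ0 : 0 < corr ξ P 0) (hsum : Summable (corr ξ P)) (hσ : ∀ i, 1 ≤ i → 0 < σ i)
    (hs : Tendsto (scale σ) atTop atTop)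
    (hratio : ∀ l : ℕ, 1 ≤ l → Tendsto (fun n => σ (n + l) / σ n) atTop (𝓝 1)) (hδ : 0 < δ) :
    ∃ C > 0, ∀ᶠ n in atTop, persistenceProb σ ξ P n ≤ C * scale σ n ^ (δ - 1) := by
  set η := min 1 ((gaussianReal 0 1).real (Set.Ioi (1 / (δ / 16))))
  have hη : 0 < η :=
    lt_min one_pos (gaussianReal_real_pos 0 one_ne_zero isOpen_Ioi Set.nonempty_Ioi)
  have hexp : Real.exp (-(δ / 16 * η)) ^ 2 < 1 :=
    pow_lt_one₀ (Real.exp_pos _).le (Real.exp_lt_one_iff.2 (neg_lt_zero.2 (by positivity)))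
      two_ne_zero
  obtain ⟨t, ht⟩ := exists_isSampling (e := (1 - Real.exp (-(δ / 16 * η)) ^ 2) / 2) hρ hρ0 hsum
    hσ hs hratio (by linarith) (by linarith [sq_nonneg (Real.exp (-(δ / 16 * η)))]) hη
    (min_le_left _ _)
  have hsd := blockSd_pos hσ ht.strictMono 0
  refine ⟨2 * Real.exp (δ / 16 * η) * ((1 + √η) * blockSd σ t 0 / √η), by positivity, ?_⟩
  filter_upwards [eventually_ge_atTop (t 1)] with n hn
  have hle := ht.persistenceProb_le_rpow hξ hmean hstat hρ hρ0 hsum hσ (by positivity) hη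
    (min_le_left _ _) (min_le_right _ _) (by ring) hn
  rwa [mul_div_cancel₀ δ (by norm_num : (16 : ℝ) ≠ 0)] at hle

lemma tendsto_log_div_log_neg_one {ι : Type*} {l : Filter ι} {q s : ι → ℝ} {K : ℝ}
    (hs : Tendsto s l atTop) (hK : 0 < K) (hlower : ∀ᶠ n in l, K / s n ≤ q n)
    (hupper : ∀ δ : ℝ, 0 < δ → ∃ C > 0, ∀ᶠ n in l, q n ≤ C * s n ^ (δ - 1)) :
    Tendsto (fun n => Real.log (q n) / Real.log (s n)) l (𝓝 (-1)) := by
  have hlog : Tendsto (fun n => Real.log (s n)) l atTop := Real.tendsto_log_atTop.comp hs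
  refine tendsto_order.2 ⟨fun a ha => ?_, fun a ha => ?_⟩
  · filter_upwards [hlower, hs.eventually_gt_atTop 0, hlog.eventually_gt_atTop 0,
      hlog.eventually_gt_atTop (-Real.log K / (-1 - a))] with n hq hs0 hlog0 hlarge
    rw [div_lt_iff₀ (by linarith)] at hlarge
    rw [lt_div_iff₀ hlog0]
    have hle := Real.log_le_log (by positivity) hq
    rw [Real.log_div hK.ne' hs0.ne'] at hle
    linarith
  · obtain ⟨C, hC, hup⟩ := hupper ((a + 1) / 2) (by linarith)
    filter_upwards [hlower, hup, hs.eventually_gt_atTop 0, hlog.eventually_gt_atTop 0,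
      hlog.eventually_gt_atTop (Real.log C / ((a + 1) / 2))] with n hq hle hs0 hlog0 hlarge
    rw [div_lt_iff₀ (by linarith)] at hlarge
    rw [div_lt_iff₀ hlog0]
    have hlog_le := Real.log_le_log ((by positivity : 0 < K / s n).trans_le hq) hle
    rw [Real.log_mul hC.ne' (Real.rpow_pos_of_pos hs0 _).ne', Real.log_rpow hs0] at hlog_le
    linarith

end UpperBound

end WeightedPersistence

open WeightedPersistence in
theorem theorem1_general {Ω : Type*} [MeasurableSpace Ω] (P : Measure Ω) (ξ : ℕ → Ω → ℝ)
    (hgauss : IsGaussianProcess ξ P) (hcentered : ∀ i, ∫ ω, ξ i ω ∂P = 0)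
    (hvar : 0 < corr ξ P 0) (hstat : IsStationary ξ P) (hρ_nonneg : ∀ i, 0 ≤ corr ξ P i)
    (hρ_summable : Summable (corr ξ P)) (σ : ℕ → ℝ) (hσ_pos : ∀ i, 1 ≤ i → 0 < σ i)
    (hs : Tendsto (scale σ) atTop atTop)
    (hσ_ratio : ∀ l : ℕ, 1 ≤ l → Tendsto (fun n => σ (n + l) / σ n) atTop (𝓝 1)) :
    Tendsto (fun n => Real.log (persistenceProb σ ξ P n) / Real.log (scale σ n)) atTop
      (𝓝 (-1)) := by
  obtain ⟨K, hK, hlower⟩ := exists_div_scale_le_persistenceProb hgauss hcentered hstat hρ_nonneg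
    hvar hρ_summable hσ_pos hs
  exact tendsto_log_div_log_neg_one hs hK hlower fun δ hδ =>
    exists_persistenceProb_le_rpow hgauss hcentered hstat hρ_nonneg hvar hρ_summable hσ_pos hs
      hσ_ratio hδ

theorem theorem1 {Ω : Type*} [MeasurableSpace Ω] (P : Measure Ω) [IsProbabilityMeasure P]
    (ξ : ℕ → Ω → ℝ)
    (hgauss : IsGaussianProcess ξ P)
    (hcentered : ∀ i, ∫ ω, ξ i ω ∂P = 0)
    (hvar : ∀ i, ∫ ω, ξ i ω ^ 2 ∂P = 1)
    (hstat : WeightedPersistence.IsStationary ξ P)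
    (hρ_nonneg : ∀ i, 0 ≤ WeightedPersistence.corr ξ P i)
    (hρ_summable : Summable (WeightedPersistence.corr ξ P))
    (σ : ℕ → ℝ)
    (hσ_pos : ∀ i, 1 ≤ i → 0 < σ i)
    (hs : Tendsto (WeightedPersistence.scale σ) atTop atTop)
    (hσ_ratio : ∀ l : ℕ, 1 ≤ l → Tendsto (fun n => σ (n + l) / σ n) atTop (𝓝 1))
    (hσ_mono : ∃ C : ℝ, ∀ n m : ℕ, 1 ≤ n → n ≤ m →
      σ m / WeightedPersistence.scale σ m ≤ C * (σ n / WeightedPersistence.scale σ n)) :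
    Tendsto (fun n => Real.log (WeightedPersistence.persistenceProb σ ξ P n) /
      Real.log (WeightedPersistence.scale σ n)) atTop (𝓝 (-1)) := by
  have hcorr : WeightedPersistence.corr ξ P 0 = 1 := by
    simpa only [WeightedPersistence.corr, sq] using hvar 0
  exact theorem1_general P ξ hgauss hcentered (hcorr ▸ one_pos) hstat hρ_nonneg hρ_summable σ
    hσ_pos hs hσ_ratio
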